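/- For a finite group $G$, a commutative ring $R$ and an $R$-module $M$, let $W_G(R;M)$ be the abelian group of $G$-typical Witt vectors with coefficients, defined as follows. Choose a set $\underline{S}$ of representatives of the conjugacy classes of subgroups of $G$ and, for each $V\in\underline{S}$, a set of coset representatives $\{g_i\}$ for $G/V$. The ghost map $$w:\prod_{V\in\underline{S}}M^{\otimes_R G/V}\longrightarrow\Big(\prod_{U\le G}M^{\otimes_R G/U}\Big)^G$$ has components $$w_U(n)=\sum_{V\in\underline{S}}\ \sum_{hV\in(G/V)^U}h\cdot f_{G/V}\big(n_V^{\otimes V/U^h}\big),\qquad U^h=h^{-1}Uh,$$ where $f_{G/V}:M^{\otimes_R G/V\times V/U^h}\cong M^{\otimes_R G/U^h}$ is induced by the bijection $(g_iV,sU^h)\mapsto g_isU^h$, and for a subgroup $K\le G$ and $g\in G$ the isomorphism $g\cdot(-):M^{\otimes_R G/K}\cong M^{\otimes_R G/gKg^{-1}}$ is induced by $aK\mapsto aKg^{-1}$ (these isomorphisms also give the action of $G$ on $\prod_U M^{\otimes_R G/U}$). For a free module $Q=T(Y)$ over a free commutative ring $T=\mathbb{Z}[X]$, the image of $w$ is a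 subgroup, independent of the choices, and $W_G(T;Q)$ is this image. In general $W_G$ is the extension of this functor to all pairs $(R;M)$ that preserves reflexive coequalisers, i.e. $W_G(R;M)$ is the coequaliser of the two maps $W_G(FUFU(R;M))\rightrightarrows W_G(FU(R;M))$ induced by $\varepsilon_{FU(R;M)}$ and $FU(\varepsilon_{(R;M)})$, where $F\dashv U$ is the adjunction between pairs of sets and pairs (commutative ring; module), $F(X,Y)=(\mathbb{Z}[X];\mathbb{Z}[X](Y))$, with counit $\varepsilon$. Let $D_6$ be the dihedral group of order $6$. Then $W_{D_6}(\mathbb{Z};\mathbb{Z}/3\mathbb{Z})$ is an abelian group of order $81$, and $$W_{D_6}(\mathbb{Z};\mathbb{Z}/3\mathbb{Z})\cong(\mathbb{Z}/3\mathbb{Z})^2\oplus\mathbb{Z}/9\mathbb{Z}.$$ -/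

import Mathlib

open scoped TensorProduct Pointwise

noncomputable section

namespace GWitt

/-! ### Tensor powers indexed by sets -/

section Tensor

variable {R R' : Type*} [CommRing R] [CommRing R']
variable {M M' : Type*} [AddCommGroup M] [Module R M] [AddCommGroup M'] [Module R' M']

/-- A morphism `(α; f) : (R; M) → (R'; M')` of modules over varying rings induces an
`α`-semilinear map `M^{⊗_R I} → M'^{⊗_{R'} I}`, `⨂ mᵢ ↦ ⨂ f mᵢ`. -/
def tensorMap (α : R →+* R') (f : M →ₛₗ[α] M') (I : Type*) :
    (⨂[R] _ : I, M) →ₛₗ[α] (⨂[R'] _ : I, M') :=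
  letI : Module R (⨂[R'] _ : I, M') := Module.compHom _ α
  let L : (⨂[R] _ : I, M) →ₗ[R] (⨂[R'] _ : I, M') :=
    PiTensorProduct.lift
      { toFun := fun m => PiTensorProduct.tprod R' fun i => f (m i)
        map_update_add' := by
          intro _ m i x y
          have h : ∀ z : M, (fun j => f (Function.update m i z j)) =
              Function.update (fun j => f (m j)) i (f z) := by
            intro z; ext j
            by_cases hj : j = i
            · subst hj; simp
            · simp [hj]
          simp only [h, map_add, MultilinearMap.map_update_add]
        map_update_smul' := by
          intro _ m i c x
          have h : ∀ z : M, (fun j => f (Function.update m i z j)) =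
              Function.update (fun j => f (m j)) i (f z) := by
            intro z; ext j
            by_cases hj : j = i
            · subst hj; simp
            · simp [hj]
          simp only [h, map_smulₛₗ, MultilinearMap.map_update_smul]
          rfl }
  { toFun := L
    map_add' := L.map_add
    map_smul' := L.map_smul }

theorem tensorMap_tprod (α : R →+* R') (f : M →ₛₗ[α] M') (I : Type*) (m : I → M) :
    tensorMap α f I (PiTensorProduct.tprod R m) = PiTensorProduct.tprod R' fun i => f (m i) := by
  let : Module R (⨂[R'] _ : I, M') := Module.compHom _ α
  exact PiTensorProduct.lift.tprod m

variable (R M) in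
/-- Auxiliary embedding of `M^{⊗ I}` as the tensors "in column `x`" of the commutative ring
`(R ⊕ M)^{⊗ I × X}`, where `R ⊕ M` is the trivial square-zero extension:
`⨂ᵢ mᵢ` is sent to the pure tensor with entry `mᵢ` at `(i, x)` and `1` elsewhere. -/
def column (I X : Type*) [DecidableEq X] (x : X) :
    letI : Module Rᵐᵒᵖ M := Module.compHom _ ((RingHom.id R).fromOpposite mul_comm)
    haveI : IsCentralScalar R M := ⟨fun _ _ => rfl⟩
    (⨂[R] _ : I, M) →ₗ[R] (⨂[R] _ : I × X, TrivSqZeroExt R M) :=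
  letI : Module Rᵐᵒᵖ M := Module.compHom _ ((RingHom.id R).fromOpposite mul_comm)
  haveI : IsCentralScalar R M := ⟨fun _ _ => rfl⟩
  PiTensorProduct.lift
    { toFun := fun m => PiTensorProduct.tprod R fun p : I × X =>
        if p.2 = x then TrivSqZeroExt.inr (m p.1) else (1 : TrivSqZeroExt R M)
      map_update_add' := by
        classical
        intro _ m i a b
        have h : ∀ z : M, (fun p : I × X => if p.2 = x then
              TrivSqZeroExt.inr (Function.update m i z p.1) else (1 : TrivSqZeroExt R M)) =
            Function.update (fun p : I × X => if p.2 = x then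
              TrivSqZeroExt.inr (m p.1) else (1 : TrivSqZeroExt R M)) (i, x)
              (TrivSqZeroExt.inr z) := by
          intro z; ext1 p
          by_cases hp : p = (i, x)
          · subst hp; simp
          · rw [Function.update_of_ne hp]
            by_cases h2 : p.2 = x
            · have h1 : p.1 ≠ i := fun h1 => hp (Prod.ext h1 h2)
              simp [h2, h1]
            · simp [h2]
        simp only [h, TrivSqZeroExt.inr_add, MultilinearMap.map_update_add]
      map_update_smul' := by
        classical
        intro _ m i c a
        have h : ∀ z : M, (fun p : I × X => if p.2 = x then
              TrivSqZeroExt.inr (Function.update m i z p.1) else (1 : TrivSqZeroExt R M)) =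
            Function.update (fun p : I × X => if p.2 = x then
              TrivSqZeroExt.inr (m p.1) else (1 : TrivSqZeroExt R M)) (i, x)
              (TrivSqZeroExt.inr z) := by
          intro z; ext1 p
          by_cases hp : p = (i, x)
          · subst hp; simp
          · rw [Function.update_of_ne hp]
            by_cases h2 : p.2 = x
            · have h1 : p.1 ≠ i := fun h1 => hp (Prod.ext h1 h2)
              simp [h2, h1]
            · simp [h2]
        simp only [h, TrivSqZeroExt.inr_smul, MultilinearMap.map_update_smul] }

variable (R M) in
/-- The canonical multilinear map `∏_X M^{⊗ I} → (M^{⊗ I})^{⊗ X} ≅ M^{⊗ I × X}`. It is the unique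
multilinear map with `(⨂ᵢ m x i)ₓ ↦ ⨂_{(i, x)} m x i`, see `assemble_tprod`. -/
def assemble (I X : Type*) [Finite X] :
    MultilinearMap R (fun _ : X => ⨂[R] _ : I, M) (⨂[R] _ : I × X, M) :=
  letI : Module Rᵐᵒᵖ M := Module.compHom _ ((RingHom.id R).fromOpposite mul_comm)
  haveI : IsCentralScalar R M := ⟨fun _ _ => rfl⟩
  letI : DecidableEq X := Classical.decEq X
  letI : Fintype X := Fintype.ofFinite X
  (PiTensorProduct.map fun _ : I × X => TrivSqZeroExt.sndHom R M).compMultilinearMap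
    ((MultilinearMap.mkPiAlgebra R X (⨂[R] _ : I × X, TrivSqZeroExt R M)).compLinearMap
      fun x => column R M I X x)

theorem assemble_tprod (I X : Type*) [Finite X] (m : X → I → M) :
    assemble R M I X (fun x => PiTensorProduct.tprod R (m x)) =
      PiTensorProduct.tprod R fun p : I × X => m p.2 p.1 := by
  let : Module Rᵐᵒᵖ M := Module.compHom _ ((RingHom.id R).fromOpposite mul_comm)
  have : IsCentralScalar R M := ⟨fun _ _ => rfl⟩
  let : DecidableEq X := Classical.decEq X
  let : Fintype X := Fintype.ofFinite X
  have h1 : ∀ x : X, column R M I X x (PiTensorProduct.tprod R (m x)) =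
      PiTensorProduct.tprod R fun p : I × X =>
        if p.2 = x then TrivSqZeroExt.inr (m x p.1) else (1 : TrivSqZeroExt R M) := fun x =>
    PiTensorProduct.lift.tprod (m x)
  have h2 : assemble R M I X (fun x => PiTensorProduct.tprod R (m x)) =
      (PiTensorProduct.map fun _ : I × X => TrivSqZeroExt.sndHom R M)
        (∏ x, column R M I X x (PiTensorProduct.tprod R (m x))) := rfl
  rw [h2]
  simp only [h1]
  rw [← PiTensorProduct.tprod_prod, PiTensorProduct.map_tprod]
  congr 1
  ext p
  rw [Finset.prod_apply, Finset.prod_ite_eq]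
  simp

theorem tensorMap_assemble (α : R →+* R') (f : M →ₛₗ[α] M') (I X : Type*) [Finite X]
    (t : X → ⨂[R] _ : I, M) :
    tensorMap α f (I × X) (assemble R M I X t) =
      assemble R' M' I X fun x => tensorMap α f I (t x) := by
  let : Module R (⨂[R'] _ : I × X, M') := Module.compHom _ α
  let L : (⨂[R] _ : I × X, M) →ₗ[R] (⨂[R'] _ : I × X, M') :=
    { toFun := tensorMap α f (I × X)
      map_add' := map_add _
      map_smul' := fun r x => map_smulₛₗ (tensorMap α f (I × X)) r x }
  let A : MultilinearMap R (fun _ : X => ⨂[R] _ : I, M) (⨂[R'] _ : I × X, M') :=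
    L.compMultilinearMap (assemble R M I X)
  let B : MultilinearMap R (fun _ : X => ⨂[R] _ : I, M) (⨂[R'] _ : I × X, M') :=
    { toFun := fun t => assemble R' M' I X fun x => tensorMap α f I (t x)
      map_update_add' := by
        intro _ m i x y
        have h : ∀ z, (fun j => tensorMap α f I (Function.update m i z j)) =
            Function.update (fun j => tensorMap α f I (m j)) i (tensorMap α f I z) := by
          intro z; ext1 j
          by_cases hj : j = i
          · subst hj; simp
          · simp [hj]
        simp only [h, map_add, MultilinearMap.map_update_add]
      map_update_smul' := by
        intro _ m i c x
        have h : ∀ z, (fun j => tensorMap α f I (Function.update m i z j)) =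
            Function.update (fun j => tensorMap α f I (m j)) i (tensorMap α f I z) := by
          intro z; ext1 j
          by_cases hj : j = i
          · subst hj; simp
          · simp [hj]
        simp only [h, map_smulₛₗ, MultilinearMap.map_update_smul]
        rfl }
  have hAB : A = B := by
    refine MultilinearMap.ext_of_span_eq_top
      (g := fun _ : X => fun m : I → M => PiTensorProduct.tprod R m)
      (fun _ => PiTensorProduct.span_tprod_eq_top) fun m => ?_
    change tensorMap α f (I × X) (assemble R M I X fun x => PiTensorProduct.tprod R (m x)) =
      assemble R' M' I X fun x => tensorMap α f I (PiTensorProduct.tprod R (m x))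
    simp only [tensorMap_tprod, assemble_tprod]
  exact congrArg (fun C => C t) hAB

/-- The tensor power `n ↦ n^{⊗ X}`, from `M^{⊗ I}` to `M^{⊗ I × X}`. -/
def tensorPow {I : Type*} (X : Type*) [Finite X] (n : ⨂[R] _ : I, M) : ⨂[R] _ : I × X, M :=
  assemble R M I X fun _ => n

theorem tensorMap_reindex (α : R →+* R') (f : M →ₛₗ[α] M') {I J : Type*} (e : I ≃ J)
    (t : ⨂[R] _ : I, M) :
    tensorMap α f J (PiTensorProduct.reindex R (fun _ => M) e t) =
      PiTensorProduct.reindex R' (fun _ => M') e (tensorMap α f I t) := by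
  induction t using PiTensorProduct.induction_on with
  | smul_tprod r m =>
    simp only [map_smulₛₗ, PiTensorProduct.reindex_tprod, tensorMap_tprod]
    rfl
  | add x y hx hy => simp only [map_add, hx, hy]

theorem reindex_reindex_const {I J K : Type*} (e : I ≃ J) (e' : J ≃ K) (t : ⨂[R] _ : I, M) :
    PiTensorProduct.reindex R (fun _ => M) e' (PiTensorProduct.reindex R (fun _ => M) e t) =
      PiTensorProduct.reindex R (fun _ => M) (e.trans e') t :=
  PiTensorProduct.reindex_reindex (s := fun _ => M) e e' t

theorem reindex_tensorPow {I X X' : Type*} [Finite X] [Finite X'] (e : X ≃ X')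
    (n : ⨂[R] _ : I, M) :
    PiTensorProduct.reindex R (fun _ => M) ((Equiv.refl I).prodCongr e) (tensorPow X n) =
      tensorPow X' n := by
  let B : MultilinearMap R (fun _ : X => ⨂[R] _ : I, M) (⨂[R] _ : I × X', M) :=
    (MultilinearMap.domDomCongr e.symm (assemble R M I X'))
  have h : (PiTensorProduct.reindex R (fun _ => M)
      ((Equiv.refl I).prodCongr e)).toLinearMap.compMultilinearMap (assemble R M I X) = B := by
    refine MultilinearMap.ext_of_span_eq_top
      (g := fun _ : X => fun m : I → M => PiTensorProduct.tprod R m)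
      (fun _ => PiTensorProduct.span_tprod_eq_top) fun m => ?_
    change PiTensorProduct.reindex R (fun _ => M) ((Equiv.refl I).prodCongr e)
        (assemble R M I X fun x => PiTensorProduct.tprod R (m x)) =
      assemble R M I X' fun x => PiTensorProduct.tprod R (m (e.symm x))
    rw [assemble_tprod, assemble_tprod, PiTensorProduct.reindex_tprod]
    rfl
  exact congrArg (fun C => C fun _ => n) h

end Tensor

/-! ### Moving between tensor powers indexed by cosets -/

section Cosets

variable {G : Type*} [Group G]

/-- For `W = gVg⁻¹`, the bijection `G/V ≃ G/W`, `aV ↦ aVg⁻¹ = ag⁻¹W`. -/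
def cosetRightMul (g : G) {V W : Subgroup G} (hW : W = MulAut.conj g • V) : G ⧸ V ≃ G ⧸ W where
  toFun := Quotient.map' (fun a => a * g⁻¹) fun a b h => by
    rw [QuotientGroup.leftRel_apply] at h ⊢
    subst hW
    rw [Subgroup.mem_pointwise_smul_iff_inv_smul_mem]
    simpa [MulAut.smul_def, mul_assoc] using h
  invFun := Quotient.map' (fun a => a * g) fun a b h => by
    rw [QuotientGroup.leftRel_apply] at h ⊢
    subst hW
    rw [Subgroup.mem_pointwise_smul_iff_inv_smul_mem] at h
    simpa [MulAut.smul_def, mul_assoc] using h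
  left_inv := by
    refine Quotient.ind' fun a => ?_
    simp [Quotient.map'_mk'']
  right_inv := by
    refine Quotient.ind' fun a => ?_
    simp [Quotient.map'_mk'']

theorem cosetRightMul_mk (g : G) {V W : Subgroup G} (hW : W = MulAut.conj g • V) (a : G) :
    cosetRightMul g hW (a : G ⧸ V) = ((a * g⁻¹ : G) : G ⧸ W) := rfl

/-- For `W = gVg⁻¹`, the isomorphism `g · (-) : M^{⊗ G/V} ≅ M^{⊗ G/W}`. -/
def conjTensor (R M : Type*) [CommRing R] [AddCommGroup M] [Module R M] (g : G)
    {V W : Subgroup G} (hW : W = MulAut.conj g • V) :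
    (⨂[R] _ : G ⧸ V, M) ≃ₗ[R] (⨂[R] _ : G ⧸ W, M) :=
  PiTensorProduct.reindex R (fun _ => M) (cosetRightMul g hW)

theorem tensorMap_conjTensor {R R' M M' : Type*} [CommRing R] [CommRing R'] [AddCommGroup M]
    [Module R M] [AddCommGroup M'] [Module R' M'] (α : R →+* R') (f : M →ₛₗ[α] M') (g : G) {V W : Subgroup G}
    (hW : W = MulAut.conj g • V) (t : ⨂[R] _ : G ⧸ V, M) :
    tensorMap α f (G ⧸ W) (conjTensor R M g hW t) =
      conjTensor R' M' g hW (tensorMap α f (G ⧸ V) t) :=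
  tensorMap_reindex α f _ t

/-- The bijection `G/V × V/U ≃ G/U`, `(gᵢV, sU) ↦ gᵢsU`, where `gᵢ = σ (gᵢV)` are chosen coset
representatives for `G/V`. -/
def cosetProd {U V : Subgroup G} (hUV : U ≤ V) (σ : G ⧸ V → G) (hσ : ∀ x, (σ x : G ⧸ V) = x) :
    (G ⧸ V) × (V ⧸ U.subgroupOf V) ≃ G ⧸ U :=
  (Subgroup.quotientEquivProdOfLE' hUV σ hσ).symm

theorem cosetProd_mk {U V : Subgroup G} (hUV : U ≤ V) (σ : G ⧸ V → G)
    (hσ : ∀ x, (σ x : G ⧸ V) = x) (x : G ⧸ V) (s : V) :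
    cosetProd hUV σ hσ (x, (s : V ⧸ U.subgroupOf V)) = ((σ x * s : G) : G ⧸ U) := rfl

/-- The induced isomorphism `f_{G/V} : M^{⊗ G/V × V/U} ≅ M^{⊗ G/U}`. -/
def cosetTensor (R M : Type*) [CommRing R] [AddCommGroup M] [Module R M] {U V : Subgroup G}
    (hUV : U ≤ V) (σ : G ⧸ V → G) (hσ : ∀ x, (σ x : G ⧸ V) = x) :
    (⨂[R] _ : (G ⧸ V) × (V ⧸ U.subgroupOf V), M) ≃ₗ[R] (⨂[R] _ : G ⧸ U, M) :=
  PiTensorProduct.reindex R (fun _ => M) (cosetProd hUV σ hσ)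

/-- If `hV` is fixed by the left multiplication action of `U` on `G/V`, then
`U^h = h⁻¹Uh ≤ V`. -/
theorem conj_le_of_fixed {U V : Subgroup G} {h : G}
    (hfix : (h : G ⧸ V) ∈ MulAction.fixedPoints U (G ⧸ V)) : MulAut.conj h⁻¹ • U ≤ V := by
  intro x hx
  rw [Subgroup.mem_pointwise_smul_iff_inv_smul_mem] at hx
  have h1 := hfix ⟨_, hx⟩
  have h2 : (((MulAut.conj h⁻¹)⁻¹ • x * h : G) : G ⧸ V) = (h : G ⧸ V) := h1
  rw [eq_comm, QuotientGroup.eq] at h2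
  simpa [MulAut.smul_def, mul_assoc] using h2

theorem eq_conj_conj_inv (h : G) (U : Subgroup G) :
    U = MulAut.conj h • (MulAut.conj h⁻¹ • U) := by
  rw [map_inv, smul_inv_smul]

end Cosets

/-! ### The ghost map -/

section Ghost

/-- The arbitrary choices in the definition of the ghost map: a set of distinguished
representatives for the conjugacy classes of subgroups of `G`, and for each distinguished
subgroup `V` a set of coset representatives for `G/V`. -/
structure Choices (G : Type*) [Group G] where
  /-- The distinguished subgroups. -/
  reps : Set (Subgroup G)
  /-- Every subgroup is conjugate to exactly one distinguished subgroup. -/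
  existsUnique_conj : ∀ U : Subgroup G, ∃! V, V ∈ reps ∧ ∃ g : G, V = MulAut.conj g • U
  /-- The chosen representative of each coset in `G/V`. -/
  cosetRep : ∀ V : reps, G ⧸ V.1 → G
  cosetRep_mk : ∀ (V : reps) (x : G ⧸ V.1), (cosetRep V x : G ⧸ V.1) = x

theorem nonempty_choices (G : Type*) [Group G] : Nonempty (Choices G) := by
  let s : Setoid (Subgroup G) :=
    { r := fun U V => ∃ g : G, V = MulAut.conj g • U
      iseqv :=
        { refl := fun U => ⟨1, by simp⟩
          symm := by
            rintro U _ ⟨g, rfl⟩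
            exact ⟨g⁻¹, by rw [map_inv, inv_smul_smul]⟩
          trans := by
            rintro U _ _ ⟨g, rfl⟩ ⟨h, rfl⟩
            exact ⟨h * g, by rw [map_mul, mul_smul]⟩ } }
  refine ⟨⟨Set.range fun q : Quotient s => q.out, fun U => ?_, fun _ x => x.out,
    fun _ x => QuotientGroup.out_eq' x⟩⟩
  have hU : s U (Quotient.mk s U).out := s.symm (Quotient.mk_out U)
  refine ⟨(Quotient.mk s U).out, ⟨⟨_, rfl⟩, hU⟩, ?_⟩
  rintro _ ⟨⟨q, rfl⟩, h⟩
  have h1 : Quotient.mk s U = Quotient.mk s q.out := Quotient.sound h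
  rw [Quotient.out_eq] at h1
  change q.out = _
  rw [h1]

variable {G : Type*} [Group G] [Finite G]
variable (R M : Type*) [CommRing R] [AddCommGroup M] [Module R M]

/-- The element `h · f_{G/V}(n^{⊗ V/U^h})` of `M^{⊗ G/U}`, for `n ∈ M^{⊗ G/V}` and `U^h ≤ V`. -/
def ghostTerm {U V : Subgroup G} (σ : G ⧸ V → G) (hσ : ∀ x, (σ x : G ⧸ V) = x) (h : G)
    (hUV : MulAut.conj h⁻¹ • U ≤ V) (n : ⨂[R] _ : G ⧸ V, M) : ⨂[R] _ : G ⧸ U, M :=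
  conjTensor R M h (eq_conj_conj_inv h U)
    (cosetTensor R M hUV σ hσ
      (tensorPow (V ⧸ (MulAut.conj h⁻¹ • U).subgroupOf V) n))

/-- The `U`-component of the ghost map,
`w_U(n) = ∑_V ∑_{hV ∈ (G/V)^U} h · f_{G/V}(n_V^{⊗ V/U^h})`, where `V` runs through the
distinguished subgroups; by `ghostTerm_conj` (with `a = 1`) the summand does not depend on the
choice of the representative `h` of `hV`. -/
def ghostComponent (c : Choices G) (n : ∀ V : c.reps, ⨂[R] _ : G ⧸ V.1, M) (U : Subgroup G) :
    ⨂[R] _ : G ⧸ U, M :=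
  ∑ᶠ (V : c.reps) (x : MulAction.fixedPoints U (G ⧸ V.1)),
    ghostTerm R M (c.cosetRep V) (c.cosetRep_mk V) x.1.out
      (conj_le_of_fixed (by rw [QuotientGroup.out_eq']; exact x.2)) (n V)

variable {R M}

theorem ghostTerm_conj {U U' V : Subgroup G} (σ : G ⧸ V → G) (hσ : ∀ x, (σ x : G ⧸ V) = x)
    (a : G) (hU' : U' = MulAut.conj a • U) (h h' : G) (hh : (h' : G ⧸ V) = ((a * h : G) : G ⧸ V))
    (hUV : MulAut.conj h⁻¹ • U ≤ V) (hUV' : MulAut.conj h'⁻¹ • U' ≤ V)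
    (n : ⨂[R] _ : G ⧸ V, M) :
    conjTensor R M a hU' (ghostTerm R M σ hσ h hUV n) = ghostTerm R M σ hσ h' hUV' n := by
  subst hU'
  obtain ⟨v, rfl⟩ : ∃ v : V, h' = a * h * v :=
    ⟨⟨(a * h)⁻¹ * h', QuotientGroup.eq.1 hh.symm⟩, by simp [mul_assoc]⟩
  let e : (V ⧸ (MulAut.conj h⁻¹ • U).subgroupOf V) ≃
      (V ⧸ (MulAut.conj (a * h * v)⁻¹ • MulAut.conj a • U).subgroupOf V) :=
    cosetRightMul v⁻¹ (by
      ext x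
      simp only [Subgroup.mem_subgroupOf, Subgroup.mem_pointwise_smul_iff_inv_smul_mem]
      simp [MulAut.smul_def, mul_assoc])
  unfold ghostTerm
  rw [← reindex_tensorPow e]
  unfold conjTensor cosetTensor
  rw [reindex_reindex_const, reindex_reindex_const, reindex_reindex_const,
    reindex_reindex_const]
  congr 2
  ext ⟨x, y⟩
  induction y using QuotientGroup.induction_on with
  | H s =>
    have h1 : e (s : V ⧸ (MulAut.conj h⁻¹ • U).subgroupOf V) =
      ((s * v : V) : V ⧸ (MulAut.conj (a * h * v)⁻¹ • MulAut.conj a • U).subgroupOf V) := by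
      simp [e, cosetRightMul_mk]
    simp only [Equiv.trans_apply, Equiv.prodCongr_apply, Prod.map, Equiv.refl_apply, h1,
      cosetProd_mk, cosetRightMul_mk]
    simp [mul_assoc]

theorem ghostComponent_conj (c : Choices G) (n : ∀ V : c.reps, ⨂[R] _ : G ⧸ V.1, M) (a : G)
    {U U' : Subgroup G} (hU' : U' = MulAut.conj a • U) :
    conjTensor R M a hU' (ghostComponent R M c n U) = ghostComponent R M c n U' := by
  have key : ∀ (V : Subgroup G) (x : G ⧸ V),
      x ∈ MulAction.fixedPoints U (G ⧸ V) ↔ a • x ∈ MulAction.fixedPoints U' (G ⧸ V) := by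
    subst hU'
    intro V x
    constructor
    · rintro hx ⟨_, u, hu, rfl⟩
      have h1 : u • x = x := hx ⟨u, hu⟩
      change (a * u * a⁻¹) • a • x = a • x
      rw [smul_smul, inv_mul_cancel_right, mul_smul, h1]
    · rintro hx ⟨u, hu⟩
      have h1 : (a * u * a⁻¹) • a • x = a • x := hx ⟨a * u * a⁻¹, u, hu, rfl⟩
      rw [smul_smul, inv_mul_cancel_right, mul_smul] at h1
      exact smul_left_cancel a h1
  unfold ghostComponent
  change (conjTensor R M a hU').toLinearMap.toAddMonoidHom _ = _
  rw [AddMonoidHom.map_finsum _ (Set.toFinite _)]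
  refine finsum_congr fun V => ?_
  rw [AddMonoidHom.map_finsum _ (Set.toFinite _)]
  let e : MulAction.fixedPoints U (G ⧸ V.1) ≃ MulAction.fixedPoints U' (G ⧸ V.1) :=
    (MulAction.toPerm a).subtypeEquiv (key V.1)
  refine finsum_eq_of_bijective e e.bijective fun x => ?_
  refine ghostTerm_conj _ _ a hU' _ _ ?_ _ _ _
  have h1 : (((e x).1.out : G) : G ⧸ V.1) = a • x.1 := QuotientGroup.out_eq' _
  rw [h1]
  conv_lhs => rw [← QuotientGroup.out_eq' x.1]
  rfl

variable (G R M) in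
/-- The ghost group `(∏_{U ≤ G} M^{⊗ G/U})^G`, where `g ∈ G` acts by sending the `U`-component
`a_U` to the `gUg⁻¹`-component `g · a_U`. -/
def ghostGroup : AddSubgroup (∀ U : Subgroup G, ⨂[R] _ : G ⧸ U, M) where
  carrier := {a | ∀ (g : G) (U : Subgroup G),
    conjTensor R M g rfl (a U) = a (MulAut.conj g • U)}
  zero_mem' := fun _ _ => map_zero _
  add_mem' := fun ha hb g U => by simp only [Pi.add_apply, map_add, ha g U, hb g U]
  neg_mem' := fun ha g U => by simp only [Pi.neg_apply, map_neg, ha g U]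

variable (R M) in
/-- The ghost map `w : ∏_V M^{⊗ G/V} → (∏_U M^{⊗ G/U})^G`, not additive in general. -/
def ghostMap (c : Choices G) (n : ∀ V : c.reps, ⨂[R] _ : G ⧸ V.1, M) : ghostGroup G R M :=
  ⟨ghostComponent R M c n, fun g _ => ghostComponent_conj c n g rfl⟩

variable {R' M' : Type*} [CommRing R'] [AddCommGroup M'] [Module R' M']

theorem tensorMap_ghostTerm (α : R →+* R') (f : M →ₛₗ[α] M') {U V : Subgroup G} (σ : G ⧸ V → G)
    (hσ : ∀ x, (σ x : G ⧸ V) = x) (h : G) (hUV : MulAut.conj h⁻¹ • U ≤ V)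
    (n : ⨂[R] _ : G ⧸ V, M) :
    tensorMap α f (G ⧸ U) (ghostTerm R M σ hσ h hUV n) =
      ghostTerm R' M' σ hσ h hUV (tensorMap α f (G ⧸ V) n) := by
  unfold ghostTerm
  rw [tensorMap_conjTensor]
  unfold cosetTensor
  rw [tensorMap_reindex]
  unfold tensorPow
  rw [tensorMap_assemble]

variable (G) in
/-- Functoriality of the ghost group in the module. -/
def ghostGroupMap (α : R →+* R') (f : M →ₛₗ[α] M') : ghostGroup G R M →+ ghostGroup G R' M' where
  toFun a := ⟨fun U => tensorMap α f (G ⧸ U) (a.1 U), fun g U => by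
    rw [← tensorMap_conjTensor, a.2 g U]⟩
  map_zero' := Subtype.ext <| funext fun _ => map_zero _
  map_add' _ _ := Subtype.ext <| funext fun _ => map_add _ _ _

/-- Naturality of the ghost map. -/
theorem ghostGroupMap_ghostMap (c : Choices G) (α : R →+* R') (f : M →ₛₗ[α] M')
    (n : ∀ V : c.reps, ⨂[R] _ : G ⧸ V.1, M) :
    ghostGroupMap G α f (ghostMap R M c n) =
      ghostMap R' M' c fun V => tensorMap α f (G ⧸ V.1) (n V) := by
  refine Subtype.ext <| funext fun U => ?_
  change (tensorMap α f (G ⧸ U)).toAddMonoidHom (ghostComponent R M c n U) = _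
  unfold ghostMap ghostComponent
  rw [AddMonoidHom.map_finsum _ (Set.toFinite _)]
  refine finsum_congr fun V => ?_
  rw [AddMonoidHom.map_finsum _ (Set.toFinite _)]
  exact finsum_congr fun x => tensorMap_ghostTerm α f _ _ _ _ _

end Ghost

/-! ### Free coefficients, and the extension to all coefficients

A free object of the category of modules over varying commutative rings is a pair `(T; Q)` with
`T = ℤ[X]` the polynomial ring and `Q = T(Y)` the free `T`-module on sets `X` and `Y`. -/

section Witt

/-- The semilinear map out of the free module `ℤ[X](Y)` given on the basis by `φ : Y → M`. -/
def freeLift {X Y R M : Type*} [CommRing R] [AddCommGroup M] [Module R M]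
    (α : MvPolynomial X ℤ →+* R) (φ : Y → M) : (Y →₀ MvPolynomial X ℤ) →ₛₗ[α] M where
  toFun q := q.sum fun y t => α t • φ y
  map_add' p q := Finsupp.sum_add_index' (by simp) (by simp [add_smul])
  map_smul' t q := by
    rw [Finsupp.sum_smul_index' (by simp), Finsupp.smul_sum]
    simp [mul_smul]

/-- The counit `ε : FU(R; M) → (R; M)` of the free-forgetful adjunction, on rings:
`ℤ[R] → R`, `X_r ↦ r`. -/
def counitRing (R : Type*) [CommRing R] : MvPolynomial R ℤ →+* R :=
  MvPolynomial.eval₂Hom (Int.castRingHom R) id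

/-- The counit `ε : FU(R; M) → (R; M)` of the free-forgetful adjunction, on modules:
`ℤ[R](M) → M`, sending the basis element of `m` to `m`. -/
def counitModule (R M : Type*) [CommRing R] [AddCommGroup M] [Module R M] :
    (M →₀ MvPolynomial R ℤ) →ₛₗ[counitRing R] M :=
  freeLift (counitRing R) id

/-- The functor `F : (X, Y) ↦ (ℤ[X]; ℤ[X](Y))` on maps of sets, ring part. -/
def freeMapRing {X X' : Type*} (a : X → X') : MvPolynomial X ℤ →+* MvPolynomial X' ℤ :=
  (MvPolynomial.rename a).toRingHom

/-- The functor `F : (X, Y) ↦ (ℤ[X]; ℤ[X](Y))` on maps of sets, module part. -/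
def freeMapModule {X X' Y Y' : Type*} (a : X → X') (b : Y → Y') :
    (Y →₀ MvPolynomial X ℤ) →ₛₗ[freeMapRing a] (Y' →₀ MvPolynomial X' ℤ) :=
  freeLift (freeMapRing a) fun y => Finsupp.single (b y) 1

variable {G : Type*} [Group G] [Finite G]

/-- The Witt vectors `W_G(T; Q)` with free coefficients `T = ℤ[X]`, `Q = T(Y)`: the image of the
ghost map. For free coefficients this image is already a subgroup of the ghost group (Dwork's
lemma); the subgroup generated by the image is used so that the definition does not rest on that
lemma. -/
def wittFree (c : Choices G) (X Y : Type*) :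
    AddSubgroup (ghostGroup G (MvPolynomial X ℤ) (Y →₀ MvPolynomial X ℤ)) :=
  AddSubgroup.closure (Set.range (ghostMap (MvPolynomial X ℤ) (Y →₀ MvPolynomial X ℤ) c))

/-- Functoriality of `W_G(T; Q)` for arbitrary morphisms between free objects. -/
def wittFreeMap (c : Choices G) {X Y X' Y' : Type*} (α : MvPolynomial X ℤ →+* MvPolynomial X' ℤ)
    (f : (Y →₀ MvPolynomial X ℤ) →ₛₗ[α] (Y' →₀ MvPolynomial X' ℤ)) :
    wittFree c X Y →+ wittFree c X' Y' :=
  ((ghostGroupMap G α f).comp (wittFree c X Y).subtype).codRestrict (wittFree c X' Y') fun x => by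
    have h : wittFree c X Y ≤ (wittFree c X' Y').comap (ghostGroupMap G α f) := by
      refine (AddSubgroup.closure_le _).2 ?_
      rintro _ ⟨n, rfl⟩
      change ghostGroupMap G α f _ ∈ wittFree c X' Y'
      rw [ghostGroupMap_ghostMap]
      exact AddSubgroup.subset_closure ⟨_, rfl⟩
    exact h x.2

/-- The `G`-typical Witt vectors `W_G(R; M)` of a finite group `G`, with coefficients in a module
`M` over a commutative ring `R`: the value at `(R; M)` of the reflexive coequaliser preserving
extension of `W_G` from free coefficients, i.e. the coequaliser of abelian groups of
`W_G(FUFU(R; M)) ⇉ W_G(FU(R; M))`, where the two maps are induced by `ε_{FU(R; M)}` and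
`FU(ε_{(R; M)})`, for `F ⊣ U` the free-forgetful adjunction between pairs of sets and modules over
varying commutative rings. -/
def WittVectors (c : Choices G) (R M : Type*) [CommRing R] [AddCommGroup M] [Module R M] :
    Type _ :=
  wittFree c R M ⧸
    (wittFreeMap c (counitRing (MvPolynomial R ℤ))
        (counitModule (MvPolynomial R ℤ) (M →₀ MvPolynomial R ℤ)) -
      wittFreeMap c (freeMapRing (counitRing R))
        (freeMapModule (counitRing R) (counitModule R M))).range

instance (c : Choices G) (R M : Type*) [CommRing R] [AddCommGroup M] [Module R M] :
    AddCommGroup (WittVectors c R M) :=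
  inferInstanceAs (AddCommGroup (_ ⧸ _))

end Witt

end GWitt

end

open scoped TensorProduct Pointwise

noncomputable section

namespace GWitt

/-! ### Tensor powers of `ℤ` -/

section IntTensor

/-! Over `(ℤ; ℤ)` every tensor power is a copy of `ℤ`, so a ghost vector is a list of integers
("marks"), one for each conjugacy class of subgroups. In the dihedral group of order 6 the classes
are separated by the orders 1, 2, 3, 6, and the ghost map reads m₆ = n₆, m₃ = 2n₃ + n₆², m₂ = n₂ +
n₆³, m₁ = 6n₁ + 3n₂² + 2n₃³ + n₆⁶. Its image is the subgroup m₃ ≡ m₆ and m₁ ≡ m₂ mod 2, m₁ ≡ m₃ mod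
3 (`mark_congr_of_mem_closure`, `exists_mark_ghostMap_eq`).

Replacing the module `ℤ` by `ℤ/3` amounts to remembering only the residues of the nᵢ mod 3. The
triple (m₆ mod 3, m₂ mod 3, m₁ mod 9) depends only on these residues
(`reducedMarks_ghostMap_congr`), vanishes only if all of them do
(`intTensor_eq_zero_of_reducedMarks_eq_zero`), and takes every value
(`exists_reducedMarks_ghostMap_eq`). The mark m₃ adds nothing, being congruent to m₁ mod 3.

To compare this with the coequaliser, `(ℤ; ℤ)` is made a retract of the free object `FU(ℤ; ℤ/3)` by
`unitFree` and `evalFree`. The homotopy `homotopyRing`, `homotopyModule` shows that `unitFree ∘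
evalFree` acts as the identity on the coequaliser, and `threeRelation` kills the vectors whose
components are divisible by 3. Thus the relations are exactly the kernel of the reduced marks
(`ker_wittReducedMarks`). -/

/-- The isomorphism `ℤ^{⊗ I} ≅ ℤ` given by multiplication. -/
def intTensor (I : Type*) [Finite I] : (⨂[ℤ] _ : I, ℤ) ≃ₗ[ℤ] ℤ :=
  letI : Fintype I := Fintype.ofFinite I
  (PiTensorProduct.constantBaseRingEquiv I ℤ).toLinearEquiv

theorem intTensor_tprod {I : Type*} [Fintype I] (m : I → ℤ) :
    intTensor I (PiTensorProduct.tprod ℤ m) = ∏ i, m i := by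
  have h := @PiTensorProduct.constantBaseRingEquiv_tprod I ℤ _ (Fintype.ofFinite I) m
  refine h.trans (Finset.prod_congr ?_ fun _ _ => rfl)
  ext; simp

theorem intTensor_reindex {I J : Type*} [Finite I] [Finite J] (e : I ≃ J) (t : ⨂[ℤ] _ : I, ℤ) :
    intTensor J (PiTensorProduct.reindex ℤ (fun _ => ℤ) e t) = intTensor I t := by
  have := Fintype.ofFinite I
  have := Fintype.ofFinite J
  induction t using PiTensorProduct.induction_on with
  | smul_tprod r m =>
    simp only [map_smul, PiTensorProduct.reindex_tprod, intTensor_tprod]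
    rw [Equiv.prod_comp e.symm m]
  | add x y hx hy => simp only [map_add, hx, hy]

theorem eq_intTensor_smul {I : Type*} [Finite I] (t : ⨂[ℤ] _ : I, ℤ) :
    t = intTensor I t • PiTensorProduct.tprod ℤ fun _ => (1 : ℤ) := by
  have := Fintype.ofFinite I
  apply (intTensor I).injective
  rw [map_smul, intTensor_tprod]
  simp

/-- `ℤ^{⊗ I}` is free of rank one on `⨂ 1`, so multilinearity of `assemble` pulls the scalar
`intTensor I n` out of each of the `Nat.card X` slots. -/
theorem intTensor_tensorPow {I : Type*} [Finite I] (X : Type*) [Finite X] (n : ⨂[ℤ] _ : I, ℤ) :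
    intTensor (I × X) (tensorPow X n) = intTensor I n ^ Nat.card X := by
  have := Fintype.ofFinite I
  have := Fintype.ofFinite X
  have h := (assemble ℤ ℤ I X).map_smul_univ (fun _ => intTensor I n)
    (fun _ => PiTensorProduct.tprod ℤ fun _ => (1 : ℤ))
  unfold tensorPow
  conv_lhs => rw [eq_intTensor_smul n]
  rw [h, assemble_tprod, map_smul, intTensor_tprod]
  simp [Nat.card_eq_fintype_card]

end IntTensor

/-! ### Functoriality of tensor powers -/

section Functoriality

variable {R R' R'' : Type*} [CommRing R] [CommRing R'] [CommRing R'']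
variable {M M' M'' : Type*} [AddCommGroup M] [Module R M] [AddCommGroup M'] [Module R' M']
  [AddCommGroup M''] [Module R'' M'']

/-- The composite is passed as separate data `γ`, `k` with pointwise equations, so that it applies
to composites that are equal without being definitionally so. -/
theorem tensorMap_tensorMap {α : R →+* R'} {β : R' →+* R''} {γ : R →+* R''} (f : M →ₛₗ[α] M')
    (g : M' →ₛₗ[β] M'') (k : M →ₛₗ[γ] M'') (hγ : ∀ r, β (α r) = γ r) (hk : ∀ m, g (f m) = k m)
    (I : Type*) (t : ⨂[R] _ : I, M) :
    tensorMap β g I (tensorMap α f I t) = tensorMap γ k I t := by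
  induction t using PiTensorProduct.induction_on with
  | smul_tprod r m => simp only [map_smulₛₗ, tensorMap_tprod, hγ, hk]
  | add x y hx hy => simp only [map_add, hx, hy]

theorem tensorMap_eq_self {α : R →+* R} (f : M →ₛₗ[α] M) (hα : ∀ r, α r = r) (hf : ∀ m, f m = m)
    (I : Type*) (t : ⨂[R] _ : I, M) : tensorMap α f I t = t := by
  induction t using PiTensorProduct.induction_on with
  | smul_tprod r m => simp only [map_smulₛₗ, tensorMap_tprod, hα, hf]
  | add x y hx hy => simp only [map_add, hx, hy]

variable {G : Type*} [Group G]

theorem ghostGroupMap_ghostGroupMap {α : R →+* R'} {β : R' →+* R''} {γ : R →+* R''}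
    (f : M →ₛₗ[α] M') (g : M' →ₛₗ[β] M'') (k : M →ₛₗ[γ] M'') (hγ : ∀ r, β (α r) = γ r)
    (hk : ∀ m, g (f m) = k m) (a : ghostGroup G R M) :
    ghostGroupMap G β g (ghostGroupMap G α f a) = ghostGroupMap G γ k a :=
  Subtype.ext <| funext fun _ => tensorMap_tensorMap f g k hγ hk _ _

theorem ghostGroupMap_eq_self {α : R →+* R} (f : M →ₛₗ[α] M) (hα : ∀ r, α r = r)
    (hf : ∀ m, f m = m) (a : ghostGroup G R M) : ghostGroupMap G α f a = a :=
  Subtype.ext <| funext fun _ => tensorMap_eq_self f hα hf _ _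

end Functoriality

/-! ### Marks: the ghost map with coefficients `(ℤ; ℤ)` -/

section Marks

variable {G : Type*} [Group G] [Finite G]

/-- The `U`-component of an element of the ghost group of `(ℤ; ℤ)`, as an integer. -/
def mark (U : Subgroup G) : ghostGroup G ℤ ℤ →+ ℤ :=
  (intTensor (G ⧸ U)).toLinearMap.toAddMonoidHom.comp
    ((Pi.evalAddMonoidHom _ U).comp (ghostGroup G ℤ ℤ).subtype)

theorem mark_apply (U : Subgroup G) (a : ghostGroup G ℤ ℤ) :
    mark U a = intTensor (G ⧸ U) (a.1 U) := rfl

theorem mark_conj (g : G) (U : Subgroup G) (a : ghostGroup G ℤ ℤ) :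
    mark (MulAut.conj g • U) a = mark U a := by
  rw [mark_apply, ← a.2 g U]
  exact intTensor_reindex _ _

/-- Elements of the ghost group are invariant, so marks are constant on conjugacy classes and the
distinguished subgroups suffice. -/
theorem ext_mark (c : Choices G) {a b : ghostGroup G ℤ ℤ}
    (h : ∀ V ∈ c.reps, mark V a = mark V b) : a = b := by
  refine Subtype.ext <| funext fun U => (intTensor (G ⧸ U)).injective ?_
  obtain ⟨_, ⟨hV, g, rfl⟩, -⟩ := c.existsUnique_conj U
  have h1 := h _ hV
  rw [mark_conj, mark_conj] at h1
  exact h1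

/-- Conjugation and `f_{G/V}` only permute tensor factors, which a product of integers does not see.
What remains is the power with exponent the index of `U^h` in `V`. -/
theorem intTensor_ghostTerm {U V : Subgroup G} (σ : G ⧸ V → G) (hσ : ∀ x, (σ x : G ⧸ V) = x)
    (h : G) (hUV : MulAut.conj h⁻¹ • U ≤ V) (n : ⨂[ℤ] _ : G ⧸ V, ℤ) :
    intTensor (G ⧸ U) (ghostTerm ℤ ℤ σ hσ h hUV n) =
      intTensor (G ⧸ V) n ^ (Nat.card V / Nat.card U) := by
  unfold ghostTerm conjTensor cosetTensor
  rw [intTensor_reindex, intTensor_reindex, intTensor_tensorPow]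
  congr 1
  have h1 : Nat.card (MulAut.conj h⁻¹ • U : Subgroup G) = Nat.card U :=
    Nat.card_congr (Subgroup.equivSMul _ U).symm.toEquiv
  have h2 := Subgroup.card_mul_index ((MulAut.conj h⁻¹ • U).subgroupOf V)
  rw [Nat.card_congr (Subgroup.subgroupOfEquivOfLe hUV).toEquiv, h1] at h2
  rw [← h2, Nat.mul_div_cancel_left _ Nat.card_pos]
  rfl

theorem mark_ghostMap (c : Choices G) (n : ∀ V : c.reps, ⨂[ℤ] _ : G ⧸ V.1, ℤ) (U : Subgroup G) :
    mark U (ghostMap ℤ ℤ c n) = ∑ᶠ V : c.reps, (Nat.card (MulAction.fixedPoints U (G ⧸ V.1)) : ℤ) *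
      intTensor (G ⧸ V.1) (n V) ^ (Nat.card V.1 / Nat.card U) := by
  change (intTensor (G ⧸ U)).toLinearMap.toAddMonoidHom (ghostComponent ℤ ℤ c n U) = _
  unfold ghostComponent
  rw [AddMonoidHom.map_finsum _ (Set.toFinite _)]
  refine finsum_congr fun V => ?_
  rw [AddMonoidHom.map_finsum _ (Set.toFinite _)]
  have h : ∀ x : MulAction.fixedPoints U (G ⧸ V.1),
      (intTensor (G ⧸ U)).toLinearMap.toAddMonoidHom
        (ghostTerm ℤ ℤ (c.cosetRep V) (c.cosetRep_mk V) x.1.out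
          (conj_le_of_fixed (by rw [QuotientGroup.out_eq']; exact x.2)) (n V)) =
      intTensor (G ⧸ V.1) (n V) ^ (Nat.card V.1 / Nat.card U) :=
    fun x => intTensor_ghostTerm _ _ _ _ _
  have := Fintype.ofFinite (MulAction.fixedPoints U (G ⧸ V.1))
  rw [finsum_congr h, finsum_eq_sum_of_fintype, Finset.sum_const, Finset.card_univ,
    ← Nat.card_eq_fintype_card, nsmul_eq_mul]

end Marks

/-! ### Subgroups of the dihedral group of order `6` -/

section Dihedral

theorem card_dihedralGroup_three : Nat.card (DihedralGroup 3) = 6 := by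
  rw [DihedralGroup.nat_card]

theorem card_subgroup_dihedral (U : Subgroup (DihedralGroup 3)) :
    Nat.card U = 1 ∨ Nat.card U = 2 ∨ Nat.card U = 3 ∨ Nat.card U = 6 := by
  have h := Subgroup.card_subgroup_dvd_card U
  rw [card_dihedralGroup_three] at h
  have h1 := Nat.le_of_dvd (by norm_num) h
  interval_cases Nat.card U <;> omega

/-- The hypothesis `hp` says that `p` divides 6 exactly once, so subgroups of order `p` are Sylow
subgroups. -/
theorem exists_conj_of_card_eq_prime {p : ℕ} [Fact p.Prime]
    (hp : p ^ (Nat.factorization 6) p = p) {U V : Subgroup (DihedralGroup 3)}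
    (hU : Nat.card U = p) (hV : Nat.card V = p) :
    ∃ g : DihedralGroup 3, V = MulAut.conj g • U := by
  obtain ⟨g, hg⟩ := MulAction.exists_smul_eq (DihedralGroup 3)
    (Sylow.ofCard (p := p) U (by rw [card_dihedralGroup_three, hU, hp]))
    (Sylow.ofCard (p := p) V (by rw [card_dihedralGroup_three, hV, hp]))
  exact ⟨g, (congrArg (fun P : Sylow p _ => (P : Subgroup (DihedralGroup 3))) hg).symm⟩

theorem factorization_six : Nat.factorization 6 2 = 1 ∧ Nat.factorization 6 3 = 1 := by
  have h : (6 : ℕ) = 2 * 3 := rfl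
  rw [h, Nat.factorization_mul (by norm_num) (by norm_num), Nat.Prime.factorization Nat.prime_two,
    Nat.Prime.factorization Nat.prime_three]
  simp

theorem exists_conj_of_card_eq {U V : Subgroup (DihedralGroup 3)} (h : Nat.card U = Nat.card V) :
    ∃ g : DihedralGroup 3, V = MulAut.conj g • U := by
  rcases card_subgroup_dihedral V with hV | hV | hV | hV
  · rw [hV] at h
    rw [Subgroup.card_eq_one] at h hV
    subst h hV
    exact ⟨1, by simp⟩
  · exact exists_conj_of_card_eq_prime (by rw [factorization_six.1, pow_one]) (h.trans hV) hV
  · exact exists_conj_of_card_eq_prime (by rw [factorization_six.2, pow_one]) (h.trans hV) hV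
  · rw [hV] at h
    rw [← card_dihedralGroup_three, Subgroup.card_eq_iff_eq_top] at h hV
    subst h hV
    exact ⟨1, by simp⟩

variable (c : Choices (DihedralGroup 3))

theorem rep_eq_of_card_eq {V W : c.reps} (h : Nat.card V.1 = Nat.card W.1) : V = W := by
  obtain ⟨g, hg⟩ := exists_conj_of_card_eq h
  exact Subtype.ext ((c.existsUnique_conj V.1).unique ⟨V.2, 1, by simp⟩ ⟨W.2, g, hg⟩)

theorem exists_rep_card {d : ℕ} (hd : ∃ U : Subgroup (DihedralGroup 3), Nat.card U = d) :
    ∃ V : c.reps, Nat.card V.1 = d := by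
  obtain ⟨U, rfl⟩ := hd
  obtain ⟨_, ⟨hV, g, rfl⟩, -⟩ := c.existsUnique_conj U
  exact ⟨⟨_, hV⟩, Nat.card_congr (Subgroup.equivSMul _ U).symm.toEquiv⟩

theorem exists_subgroup_card_eq_prime (p : ℕ) [Fact p.Prime] (hp : p ∣ 6) :
    ∃ U : Subgroup (DihedralGroup 3), Nat.card U = p := by
  have h := Sylow.exists_subgroup_card_pow_prime (G := DihedralGroup 3) (n := 1) p
    (by rwa [card_dihedralGroup_three, pow_one])
  rwa [pow_one] at h

/-- The distinguished subgroups of order `1`, `2`, `3` and `6`. -/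
structure RepsByCard where
  (V₁ V₂ V₃ V₆ : c.reps)
  h₁ : Nat.card V₁.1 = 1
  h₂ : Nat.card V₂.1 = 2
  h₃ : Nat.card V₃.1 = 3
  h₆ : Nat.card V₆.1 = 6

theorem nonempty_repsByCard : Nonempty (RepsByCard c) := by
  have : Fact (Nat.Prime 3) := ⟨Nat.prime_three⟩
  obtain ⟨V₁, h₁⟩ := exists_rep_card c ⟨⊥, Subgroup.card_bot⟩
  obtain ⟨V₂, h₂⟩ := exists_rep_card c (exists_subgroup_card_eq_prime 2 (by norm_num))
  obtain ⟨V₃, h₃⟩ := exists_rep_card c (exists_subgroup_card_eq_prime 3 (by norm_num))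
  obtain ⟨V₆, h₆⟩ := exists_rep_card c ⟨⊤, Subgroup.card_top.trans card_dihedralGroup_three⟩
  exact ⟨⟨V₁, V₂, V₃, V₆, h₁, h₂, h₃, h₆⟩⟩

variable {c}

theorem RepsByCard.eq_or (v : RepsByCard c) (V : c.reps) :
    V = v.V₁ ∨ V = v.V₂ ∨ V = v.V₃ ∨ V = v.V₆ := by
  rcases card_subgroup_dihedral V.1 with h | h | h | h
  · exact Or.inl (rep_eq_of_card_eq c (h.trans v.h₁.symm))
  · exact Or.inr (Or.inl (rep_eq_of_card_eq c (h.trans v.h₂.symm)))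
  · exact Or.inr (Or.inr (Or.inl (rep_eq_of_card_eq c (h.trans v.h₃.symm))))
  · exact Or.inr (Or.inr (Or.inr (rep_eq_of_card_eq c (h.trans v.h₆.symm))))

theorem RepsByCard.ne (v : RepsByCard c) : v.V₁ ≠ v.V₂ ∧ v.V₁ ≠ v.V₃ ∧ v.V₁ ≠ v.V₆ ∧
    v.V₂ ≠ v.V₃ ∧ v.V₂ ≠ v.V₆ ∧ v.V₃ ≠ v.V₆ := by
  have key : ∀ {V W : c.reps}, Nat.card V.1 ≠ Nat.card W.1 → V ≠ W := by
    rintro V _ h rfl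
    exact h rfl
  refine ⟨key ?_, key ?_, key ?_, key ?_, key ?_, key ?_⟩ <;>
    simp [v.h₁, v.h₂, v.h₃, v.h₆]

theorem RepsByCard.finsum (v : RepsByCard c) {A : Type*} [AddCommMonoid A] (f : c.reps → A) :
    ∑ᶠ V, f V = f v.V₁ + f v.V₂ + f v.V₃ + f v.V₆ := by
  classical
  have := Fintype.ofFinite c.reps
  obtain ⟨h1, h2, h3, h4, h5, h6⟩ := v.ne
  have huniv : (Finset.univ : Finset c.reps) = {v.V₁, v.V₂, v.V₃, v.V₆} := by
    ext V
    simpa using v.eq_or V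
  rw [finsum_eq_sum_of_fintype, huniv, Finset.sum_insert (by simp [*]),
    Finset.sum_insert (by simp [*]), Finset.sum_insert (by simp [*]), Finset.sum_singleton]
  simp only [add_assoc]

/-- A fixed coset would embed a conjugate of `U` in `V`. This supplies the zeros that make the ghost
map triangular. -/
theorem card_fixedPoints_of_not_dvd {U V : Subgroup (DihedralGroup 3)}
    (h : ¬ Nat.card U ∣ Nat.card V) :
    Nat.card (MulAction.fixedPoints U (DihedralGroup 3 ⧸ V)) = 0 := by
  have : IsEmpty (MulAction.fixedPoints U (DihedralGroup 3 ⧸ V)) := by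
    refine ⟨fun x => h ?_⟩
    have h1 : MulAut.conj x.1.out⁻¹ • U ≤ V :=
      conj_le_of_fixed (by rw [QuotientGroup.out_eq']; exact x.2)
    rw [Nat.card_congr (Subgroup.equivSMul (MulAut.conj x.1.out⁻¹) U).toEquiv]
    exact Subgroup.card_dvd_of_le h1
  exact Nat.card_of_isEmpty

theorem card_quotient_dihedral {V : Subgroup (DihedralGroup 3)} :
    Nat.card (DihedralGroup 3 ⧸ V) = 6 / Nat.card V := by
  rw [← card_dihedralGroup_three, ← V.index_mul_card, Nat.mul_div_cancel _ Nat.card_pos]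
  rfl

theorem card_fixedPoints_one {U V : Subgroup (DihedralGroup 3)} (hU : Nat.card U = 1) :
    Nat.card (MulAction.fixedPoints U (DihedralGroup 3 ⧸ V)) = 6 / Nat.card V := by
  rw [Subgroup.card_eq_one] at hU
  subst hU
  have h : MulAction.fixedPoints (⊥ : Subgroup (DihedralGroup 3)) (DihedralGroup 3 ⧸ V) =
      Set.univ := by
    refine Set.eq_univ_of_forall fun x u => ?_
    rw [Subsingleton.elim u 1, one_smul]
  rw [h, ← card_quotient_dihedral]
  exact Nat.card_univ

theorem card_fixedPoints_six {U V : Subgroup (DihedralGroup 3)} (hV : Nat.card V = 6) :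
    Nat.card (MulAction.fixedPoints U (DihedralGroup 3 ⧸ V)) = 1 := by
  rw [← card_dihedralGroup_three, Subgroup.card_eq_iff_eq_top] at hV
  subst hV
  have := QuotientGroup.subsingleton_quotient_top (G := DihedralGroup 3)
  rw [Nat.card_eq_one_iff_unique]
  exact ⟨Subtype.val_injective.subsingleton, ⟨⟨((1 : DihedralGroup 3) : DihedralGroup 3 ⧸ _), fun _ =>
    Subsingleton.elim _ _⟩⟩⟩

theorem card_fixedPoints_le {U V : Subgroup (DihedralGroup 3)} :
    Nat.card (MulAction.fixedPoints U (DihedralGroup 3 ⧸ V)) ≤ 6 / Nat.card V := by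
  rw [← card_quotient_dihedral]
  exact Nat.card_le_card_of_injective _ Subtype.val_injective

/-- The number of fixed points of a 3-group on the two-element set `G/V` is congruent to 2 mod 3 and
at most 2. -/
theorem card_fixedPoints_three {U V : Subgroup (DihedralGroup 3)} (hU : Nat.card U = 3)
    (hV : Nat.card V = 3) :
    Nat.card (MulAction.fixedPoints U (DihedralGroup 3 ⧸ V)) = 2 := by
  have : Fact (Nat.Prime 3) := ⟨Nat.prime_three⟩
  have h1 := (IsPGroup.of_card (p := 3) (n := 1) hU).card_modEq_card_fixedPoints
    (DihedralGroup 3 ⧸ V)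
  have h2 := card_fixedPoints_le (U := U) (V := V)
  rw [card_quotient_dihedral, hV] at h1
  rw [hV] at h2
  unfold Nat.ModEq at h1
  omega

theorem exists_conj_ne {u : DihedralGroup 3} (hu : u ≠ 1) :
    ∃ g : DihedralGroup 3, g * u * g⁻¹ ≠ u := by
  revert u
  decide

/-- The count is odd and at most 3. Were it 3, every conjugate of `U` would lie in `V`; since the
centre is trivial (`exists_conj_ne`), `V` would then contain three distinct elements. -/
theorem card_fixedPoints_two {U V : Subgroup (DihedralGroup 3)} (hU : Nat.card U = 2)
    (hV : Nat.card V = 2) :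
    Nat.card (MulAction.fixedPoints U (DihedralGroup 3 ⧸ V)) = 1 := by
  have h1 := (IsPGroup.of_card (p := 2) (n := 1) hU).card_modEq_card_fixedPoints
    (DihedralGroup 3 ⧸ V)
  have h2 := card_fixedPoints_le (U := U) (V := V)
  rw [card_quotient_dihedral, hV] at h1
  rw [hV] at h2
  unfold Nat.ModEq at h1
  suffices Nat.card (MulAction.fixedPoints U (DihedralGroup 3 ⧸ V)) ≠ 3 by omega
  intro h3
  have huniv : MulAction.fixedPoints U (DihedralGroup 3 ⧸ V) = Set.univ := by
    refine Set.eq_of_subset_of_ncard_le (Set.subset_univ _) ?_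
    rw [Set.ncard_univ, card_quotient_dihedral, hV]
    exact h3.ge
  have hconj : ∀ (u : U) (g : DihedralGroup 3), g * u * g⁻¹ ∈ V := by
    intro u g
    have h4 : ((g⁻¹ : DihedralGroup 3) : DihedralGroup 3 ⧸ V) ∈ MulAction.fixedPoints U _ :=
      huniv ▸ Set.mem_univ _
    refine conj_le_of_fixed h4 ?_
    rw [Subgroup.mem_pointwise_smul_iff_inv_smul_mem]
    simp [MulAut.smul_def, mul_assoc]
  have : Nontrivial U := by
    rw [← Finite.one_lt_card_iff_nontrivial, hU]
    norm_num
  obtain ⟨u, hu⟩ := exists_ne (1 : U)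
  have hu' : (u : DihedralGroup 3) ≠ 1 := fun h => hu (Subtype.ext h)
  obtain ⟨g, hg⟩ := exists_conj_ne hu'
  have hsub : ({1, (u : DihedralGroup 3), g * u * g⁻¹} : Finset (DihedralGroup 3)) ⊆
      (V : Set (DihedralGroup 3)).toFinite.toFinset := by
    intro x hx
    simp only [Finset.mem_insert, Finset.mem_singleton] at hx
    rw [Set.Finite.mem_toFinset]
    rcases hx with rfl | rfl | rfl
    · exact V.one_mem
    · simpa using hconj u 1
    · exact hconj u g
  have hcard := Finset.card_le_card hsub
  rw [← Set.ncard_eq_toFinset_card _ _] at hcard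
  have h5 : (V : Set (DihedralGroup 3)).ncard = 2 := hV
  rw [h5, Finset.card_insert_of_notMem, Finset.card_pair hg.symm] at hcard
  · omega
  · simp only [Finset.mem_insert, Finset.mem_singleton, not_or]
    exact ⟨hu'.symm, fun h => hu' (by simpa using h.symm)⟩

end Dihedral

/-! ### The ghost map of the dihedral group of order `6` -/

section GhostDihedral

variable {c : Choices (DihedralGroup 3)} (v : RepsByCard c)
  (n : ∀ V : c.reps, ⨂[ℤ] _ : DihedralGroup 3 ⧸ V.1, ℤ)

theorem mark_one_ghostMap : mark v.V₁.1 (ghostMap ℤ ℤ c n) =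
    6 * intTensor _ (n v.V₁) + 3 * intTensor _ (n v.V₂) ^ 2 +
      2 * intTensor _ (n v.V₃) ^ 3 + intTensor _ (n v.V₆) ^ 6 := by
  rw [mark_ghostMap, v.finsum]
  simp only [card_fixedPoints_one v.h₁, v.h₁, v.h₂, v.h₃, v.h₆]
  norm_num

theorem mark_two_ghostMap : mark v.V₂.1 (ghostMap ℤ ℤ c n) =
    intTensor _ (n v.V₂) + intTensor _ (n v.V₆) ^ 3 := by
  rw [mark_ghostMap, v.finsum, card_fixedPoints_of_not_dvd (V := v.V₁.1) (by simp [v.h₁, v.h₂]),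
    card_fixedPoints_of_not_dvd (V := v.V₃.1) (by simp [v.h₃, v.h₂]),
    card_fixedPoints_two v.h₂ v.h₂, card_fixedPoints_six v.h₆]
  simp [v.h₂, v.h₆]

theorem mark_three_ghostMap : mark v.V₃.1 (ghostMap ℤ ℤ c n) =
    2 * intTensor _ (n v.V₃) + intTensor _ (n v.V₆) ^ 2 := by
  rw [mark_ghostMap, v.finsum, card_fixedPoints_of_not_dvd (V := v.V₁.1) (by simp [v.h₁, v.h₃]),
    card_fixedPoints_of_not_dvd (V := v.V₂.1) (by simp [v.h₃, v.h₂]),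
    card_fixedPoints_three v.h₃ v.h₃, card_fixedPoints_six v.h₆]
  simp [v.h₃, v.h₆]

theorem mark_six_ghostMap : mark v.V₆.1 (ghostMap ℤ ℤ c n) = intTensor _ (n v.V₆) := by
  rw [mark_ghostMap, v.finsum, card_fixedPoints_of_not_dvd (V := v.V₁.1) (by simp [v.h₁, v.h₆]),
    card_fixedPoints_of_not_dvd (V := v.V₂.1) (by simp [v.h₆, v.h₂]),
    card_fixedPoints_of_not_dvd (V := v.V₃.1) (by simp [v.h₆, v.h₃]), card_fixedPoints_six v.h₆]
  simp [v.h₆]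

end GhostDihedral

/-! ### The image of the ghost map of the dihedral group over `(ℤ; ℤ)` -/

section IntWitt

variable {c : Choices (DihedralGroup 3)} (v : RepsByCard c)

theorem RepsByCard.ext_mark (v : RepsByCard c) {a b : ghostGroup (DihedralGroup 3) ℤ ℤ}
    (h₁ : mark v.V₁.1 a = mark v.V₁.1 b) (h₂ : mark v.V₂.1 a = mark v.V₂.1 b)
    (h₃ : mark v.V₃.1 a = mark v.V₃.1 b) (h₆ : mark v.V₆.1 a = mark v.V₆.1 b) : a = b := by
  refine GWitt.ext_mark c fun V hV => ?_
  rcases v.eq_or ⟨V, hV⟩ with h | h | h | h <;> rw [Subtype.ext_iff] at h <;> subst h <;>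
    assumption

/-- The congruences between marks that cut out the image of the ghost map. -/
theorem mark_congr_of_mem_closure {a : ghostGroup (DihedralGroup 3) ℤ ℤ}
    (ha : a ∈ AddSubgroup.closure (Set.range (ghostMap ℤ ℤ c))) :
    (mark v.V₃.1 a : ZMod 2) = mark v.V₆.1 a ∧ (mark v.V₁.1 a : ZMod 2) = mark v.V₂.1 a ∧
      (mark v.V₁.1 a : ZMod 3) = mark v.V₃.1 a := by
  induction ha using AddSubgroup.closure_induction with
  | mem _ h =>
    obtain ⟨n, rfl⟩ := h
    rw [mark_one_ghostMap, mark_two_ghostMap, mark_three_ghostMap, mark_six_ghostMap]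
    push_cast
    -- Fermat's little theorem, checked over all residues.
    have h1 : ∀ b g : ZMod 2, 2 * b + g ^ 2 = g := by decide
    have h2 : ∀ d c b g : ZMod 2, 6 * d + 3 * c ^ 2 + 2 * b ^ 3 + g ^ 6 = c + g ^ 3 := by decide
    have h3 : ∀ d c b g : ZMod 3, 6 * d + 3 * c ^ 2 + 2 * b ^ 3 + g ^ 6 = 2 * b + g ^ 2 := by
      decide
    exact ⟨h1 _ _, h2 _ _ _ _, h3 _ _ _ _⟩
  | zero => simp
  | add a b _ _ ha hb => simp [ha, hb]
  | neg a _ ha => simp [ha]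

theorem exists_intTensor_eq (d₁ d₂ d₃ d₆ : ℤ) :
    ∃ n : ∀ V : c.reps, ⨂[ℤ] _ : DihedralGroup 3 ⧸ V.1, ℤ,
      intTensor _ (n v.V₁) = d₁ ∧ intTensor _ (n v.V₂) = d₂ ∧ intTensor _ (n v.V₃) = d₃ ∧
        intTensor _ (n v.V₆) = d₆ :=
  ⟨fun V => (intTensor _).symm (if Nat.card V.1 = 1 then d₁ else if Nat.card V.1 = 2 then d₂ else
    if Nat.card V.1 = 3 then d₃ else d₆), by simp [v.h₁, v.h₂, v.h₃, v.h₆]⟩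

/-- The triangular system is solved from the top subgroup down: n₆ = m₆, then n₂ and n₃, then n₁.
The congruences are exactly what makes the divisions by 2 and by 6 possible. -/
theorem exists_mark_ghostMap_eq {m₁ m₂ m₃ m₆ : ℤ} (h₁ : (m₃ : ZMod 2) = m₆)
    (h₂ : (m₁ : ZMod 2) = m₂) (h₃ : (m₁ : ZMod 3) = m₃) :
    ∃ n, mark v.V₁.1 (ghostMap ℤ ℤ c n) = m₁ ∧ mark v.V₂.1 (ghostMap ℤ ℤ c n) = m₂ ∧
      mark v.V₃.1 (ghostMap ℤ ℤ c n) = m₃ ∧ mark v.V₆.1 (ghostMap ℤ ℤ c n) = m₆ := by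
  obtain ⟨b, hb⟩ : (2 : ℤ) ∣ m₃ - m₆ ^ 2 := by
    refine (ZMod.intCast_zmod_eq_zero_iff_dvd _ 2).1 ?_
    push_cast
    rw [h₁]
    have h : ∀ g : ZMod 2, g - g ^ 2 = 0 := by decide
    exact h _
  have hm₃ : m₃ = 2 * b + m₆ ^ 2 := by linarith
  obtain ⟨e, he⟩ : (6 : ℤ) ∣ m₁ - m₆ ^ 6 - 2 * b ^ 3 - 3 * (m₂ - m₆ ^ 3) ^ 2 := by
    have h2 : (2 : ℤ) ∣ m₁ - m₆ ^ 6 - 2 * b ^ 3 - 3 * (m₂ - m₆ ^ 3) ^ 2 := by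
      refine (ZMod.intCast_zmod_eq_zero_iff_dvd _ 2).1 ?_
      push_cast
      rw [h₂]
      have h : ∀ g b c : ZMod 2, c - g ^ 6 - 2 * b ^ 3 - 3 * (c - g ^ 3) ^ 2 = 0 := by decide
      exact h _ _ _
    have h3 : (3 : ℤ) ∣ m₁ - m₆ ^ 6 - 2 * b ^ 3 - 3 * (m₂ - m₆ ^ 3) ^ 2 := by
      refine (ZMod.intCast_zmod_eq_zero_iff_dvd _ 3).1 ?_
      push_cast
      rw [h₃, hm₃]
      push_cast
      have h : ∀ g b c : ZMod 3,
        2 * b + g ^ 2 - g ^ 6 - 2 * b ^ 3 - 3 * (c - g ^ 3) ^ 2 = 0 := by decide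
      exact h _ _ _
    omega
  obtain ⟨n, n₁, n₂, n₃, n₆⟩ := exists_intTensor_eq v e (m₂ - m₆ ^ 3) b m₆
  refine ⟨n, ?_, ?_, ?_, ?_⟩
  · rw [mark_one_ghostMap, n₁, n₂, n₃, n₆]
    linarith
  · rw [mark_two_ghostMap, n₂, n₆]
    ring
  · rw [mark_three_ghostMap, n₃, n₆]
    linarith
  · rw [mark_six_ghostMap, n₆]

/-- Dwork's lemma in this case: the image of the ghost map is already closed under addition. -/
theorem exists_ghostMap_eq {a : ghostGroup (DihedralGroup 3) ℤ ℤ}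
    (ha : a ∈ AddSubgroup.closure (Set.range (ghostMap ℤ ℤ c))) : ∃ n, ghostMap ℤ ℤ c n = a := by
  obtain ⟨v⟩ := nonempty_repsByCard c
  obtain ⟨h₁, h₂, h₃⟩ := mark_congr_of_mem_closure v ha
  obtain ⟨n, n₁, n₂, n₃, n₆⟩ := exists_mark_ghostMap_eq v h₁ h₂ h₃
  exact ⟨n, v.ext_mark n₁ n₂ n₃ n₆⟩

theorem ghostMap_int_zero : ghostMap ℤ ℤ c 0 = 0 := by
  obtain ⟨v⟩ := nonempty_repsByCard c
  apply v.ext_mark <;>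
    simp [mark_one_ghostMap, mark_two_ghostMap, mark_three_ghostMap, mark_six_ghostMap]

/-- The marks at the subgroups of order `6` and `2` modulo `3`, and at the trivial subgroup
modulo `9`. -/
def reducedMarks : ghostGroup (DihedralGroup 3) ℤ ℤ →+ (ZMod 3 × ZMod 3) × ZMod 9 :=
  (((Int.castAddHom _).comp (mark v.V₆.1)).prod ((Int.castAddHom _).comp (mark v.V₂.1))).prod
    ((Int.castAddHom _).comp (mark v.V₁.1))

theorem reducedMarks_apply (a : ghostGroup (DihedralGroup 3) ℤ ℤ) :
    reducedMarks v a = (((mark v.V₆.1 a : ZMod 3), (mark v.V₂.1 a : ZMod 3)),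
      (mark v.V₁.1 a : ZMod 9)) := rfl

theorem exists_reducedMarks_ghostMap_eq (x : (ZMod 3 × ZMod 3) × ZMod 9) :
    ∃ n, reducedMarks v (ghostMap ℤ ℤ c n) = x := by
  obtain ⟨⟨x, y⟩, z⟩ := x
  obtain ⟨x, rfl⟩ := ZMod.intCast_surjective x
  obtain ⟨y, rfl⟩ := ZMod.intCast_surjective y
  obtain ⟨z, rfl⟩ := ZMod.intCast_surjective z
  -- The mark m₁ = z + 9(y - z) is z mod 9 and, 9 being odd, y mod 2. The mark m₃ = 3x - 2m₁ is x
  -- mod 2 and m₁ mod 3.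
  obtain ⟨n, n₁, n₂, -, n₆⟩ := exists_mark_ghostMap_eq v (m₁ := z + 9 * (y - z)) (m₂ := y)
    (m₃ := 3 * x - 2 * (z + 9 * (y - z))) (m₆ := x)
    ((ZMod.intCast_eq_intCast_iff_dvd_sub _ _ 2).2 ⟨-x + (z + 9 * (y - z)), by push_cast; ring⟩)
    ((ZMod.intCast_eq_intCast_iff_dvd_sub _ _ 2).2 ⟨4 * z - 4 * y, by push_cast; ring⟩)
    ((ZMod.intCast_eq_intCast_iff_dvd_sub _ _ 3).2
      ⟨x - (z + 9 * (y - z)), by push_cast; ring⟩)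
  refine ⟨n, ?_⟩
  rw [reducedMarks_apply, n₁, n₂, n₆]
  have h9 : (9 : ZMod 9) = 0 := by decide
  push_cast
  rw [h9, zero_mul, add_zero]

theorem intCast_pow_three_zmod_nine {x y : ℤ} (h : (x : ZMod 3) = y) :
    (x : ZMod 9) ^ 3 = (y : ZMod 9) ^ 3 := by
  obtain ⟨k, hk⟩ := (ZMod.intCast_eq_intCast_iff_dvd_sub _ _ 3).1 h
  obtain rfl : y = x + 3 * k := by push_cast at hk; linarith
  push_cast
  generalize (x : ZMod 9) = x
  generalize (k : ZMod 9) = k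
  revert x k
  decide

theorem three_mul_intCast_zmod_nine {x y : ℤ} (h : (x : ZMod 3) = y) :
    3 * (x : ZMod 9) = 3 * y := by
  obtain ⟨k, hk⟩ := (ZMod.intCast_eq_intCast_iff_dvd_sub _ _ 3).1 h
  obtain rfl : y = x + 3 * k := by push_cast at hk; linarith
  have h9 : (9 : ZMod 9) = 0 := by decide
  push_cast
  linear_combination (-k : ZMod 9) * h9

/-- Each term of m₁ = 6n₁ + 3n₂² + 2n₃³ + n₆⁶ is determined mod 9 by a residue mod 3: the first two
carry a factor 3, the last two are functions of cubes. -/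
theorem reducedMarks_ghostMap_congr
    {n n' : ∀ V : c.reps, ⨂[ℤ] _ : DihedralGroup 3 ⧸ V.1, ℤ}
    (h : ∀ V, (intTensor _ (n V) : ZMod 3) = intTensor _ (n' V)) :
    reducedMarks v (ghostMap ℤ ℤ c n) = reducedMarks v (ghostMap ℤ ℤ c n') := by
  simp only [reducedMarks_apply, mark_one_ghostMap, mark_two_ghostMap, mark_six_ghostMap]
  push_cast
  rw [h v.V₂, h v.V₆]
  congr 1
  have h₁ := three_mul_intCast_zmod_nine (h v.V₁)
  have h₂ := three_mul_intCast_zmod_nine (x := intTensor _ (n v.V₂) ^ 2)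
    (y := intTensor _ (n' v.V₂) ^ 2) (by push_cast; rw [h v.V₂])
  have h₃ := intCast_pow_three_zmod_nine (h v.V₃)
  have h₆ := intCast_pow_three_zmod_nine (h v.V₆)
  push_cast at h₂
  -- The sixth powers are compared through x⁶ - y⁶ = (x³ + y³)(x³ - y³).
  linear_combination 2 * h₁ + h₂ + 2 * h₃ +
    ((intTensor _ (n v.V₆) : ZMod 9) ^ 3 + (intTensor _ (n' v.V₆) : ZMod 9) ^ 3) * h₆

/-- The marks m₆ and m₂ give 3 ∣ n₆ and 3 ∣ n₂. Reading m₁ mod 3 gives 3 ∣ n₃, after which every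
term of m₁ except 6n₁ is divisible by 9, whence 3 ∣ n₁. -/
theorem intTensor_eq_zero_of_reducedMarks_eq_zero
    {n : ∀ V : c.reps, ⨂[ℤ] _ : DihedralGroup 3 ⧸ V.1, ℤ}
    (h : reducedMarks v (ghostMap ℤ ℤ c n) = 0) (V : c.reps) :
    (intTensor _ (n V) : ZMod 3) = 0 := by
  simp only [reducedMarks_apply, mark_one_ghostMap, mark_two_ghostMap, mark_six_ghostMap,
    Prod.mk_eq_zero] at h
  obtain ⟨⟨h₆, h₂⟩, h₁⟩ := h
  push_cast at h₂
  rw [h₆, zero_pow (by norm_num), add_zero] at h₂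
  rw [ZMod.intCast_zmod_eq_zero_iff_dvd] at h₆ h₂ h₁
  push_cast at h₆ h₂ h₁
  obtain ⟨g, hg⟩ := h₆
  obtain ⟨a, ha⟩ := h₂
  obtain ⟨k, hk⟩ := h₁
  have h₃ : (3 : ℤ) ∣ intTensor _ (n v.V₃) := by
    have h3 : (3 : ℤ) ∣ 2 * intTensor _ (n v.V₃) ^ 3 :=
      ⟨3 * k - 2 * intTensor _ (n v.V₁) - intTensor _ (n v.V₂) ^ 2 -
        g * intTensor _ (n v.V₆) ^ 5, by linear_combination hk - intTensor _ (n v.V₆) ^ 5 * hg⟩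
    exact Int.prime_three.dvd_of_dvd_pow
      ((Int.prime_three.dvd_or_dvd h3).resolve_left (by norm_num))
  obtain ⟨b, hb⟩ := h₃
  have h₁ : (3 : ℤ) ∣ intTensor _ (n v.V₁) := by
    rw [ha, hb, hg] at hk
    have : 2 * intTensor _ (n v.V₁) = 3 * (k - 3 * a ^ 2 - 6 * b ^ 3 - 81 * g ^ 6) := by linarith
    omega
  rw [ZMod.intCast_zmod_eq_zero_iff_dvd]
  rcases v.eq_or V with rfl | rfl | rfl | rfl
  · exact h₁
  · exact ⟨a, ha⟩
  · exact ⟨b, hb⟩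
  · exact ⟨g, hg⟩

end IntWitt

/-! ### The presentation of `(ℤ; ℤ/3)` by free objects -/

section Presentation

section Free

variable {X Y R M : Type*} [CommRing R] [AddCommGroup M] [Module R M]

theorem freeLift_single (α : MvPolynomial X ℤ →+* R) (φ : Y → M) (y : Y) (t : MvPolynomial X ℤ) :
    freeLift α φ (Finsupp.single y t) = α t • φ y :=
  Finsupp.sum_single_index (h := fun y t => α t • φ y) (by rw [map_zero, zero_smul])

theorem counitModule_single_one (m : M) :
    counitModule R M (Finsupp.single m 1) = m :=
  (freeLift_single _ _ _ _).trans (by rw [map_one, one_smul, id])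

theorem freeMapModule_single_one {X' Y' : Type*} (a : X → X') (b : Y → Y') (y : Y) :
    freeMapModule a b (Finsupp.single y 1) = Finsupp.single (b y) 1 :=
  (freeLift_single _ _ _ _).trans (by rw [map_one, one_smul])

variable (R) in
theorem counitRing_counitRing (p : MvPolynomial (MvPolynomial R ℤ) ℤ) :
    counitRing R (counitRing (MvPolynomial R ℤ) p) =
      counitRing R (freeMapRing (counitRing R) p) := by
  refine RingHom.congr_fun (f := (counitRing R).comp (counitRing (MvPolynomial R ℤ)))
    (g := (counitRing R).comp (freeMapRing (counitRing R))) ?_ p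
  ext <;> simp [counitRing, freeMapRing]

/-- Naturality of the counit: it coequalises the two maps of the presentation. -/
theorem counitModule_counitModule
    (q : (M →₀ MvPolynomial R ℤ) →₀ MvPolynomial (MvPolynomial R ℤ) ℤ) :
    counitModule R M (counitModule (MvPolynomial R ℤ) (M →₀ MvPolynomial R ℤ) q) =
      counitModule R M (freeMapModule (counitRing R) (counitModule R M) q) := by
  induction q using Finsupp.induction_linear with
  | zero => simp only [map_zero]
  | add p q hp hq => simp only [map_add, hp, hq]
  | single y t =>
    have h1 : counitModule (MvPolynomial R ℤ) (M →₀ MvPolynomial R ℤ) (Finsupp.single y t) =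
        counitRing _ t • y := freeLift_single _ _ _ _
    have h2 : freeMapModule (counitRing R) (counitModule R M) (Finsupp.single y t) =
        freeMapRing (counitRing R) t • Finsupp.single (counitModule R M y) 1 :=
      freeLift_single _ _ _ _
    rw [h1, h2, map_smulₛₗ, map_smulₛₗ, counitModule_single_one, counitRing_counitRing R]

end Free

/-- The morphism `(ℤ[ℤ]; ℤ[ℤ](ℤ/3)) → (ℤ; ℤ)` that evaluates variables and lifts residues. -/
def evalFree : (ZMod 3 →₀ MvPolynomial ℤ ℤ) →ₛₗ[counitRing ℤ] ℤ :=
  freeLift (counitRing ℤ) fun m => (m.val : ℤ)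

/-- `evalFree` lifts the counit along `ℤ → ℤ/3`, so its residue is insensitive to the relations
although its value is not. -/
theorem evalFree_cast (q : ZMod 3 →₀ MvPolynomial ℤ ℤ) :
    (evalFree q : ZMod 3) = counitModule ℤ (ZMod 3) q := by
  induction q using Finsupp.induction_linear with
  | zero => simp only [map_zero, Int.cast_zero]
  | add p q hp hq => simp only [map_add, Int.cast_add, hp, hq]
  | single y t =>
    have h1 : evalFree (Finsupp.single y t) = counitRing ℤ t • (y.val : ℤ) :=
      freeLift_single _ _ _ _
    have h2 : counitModule ℤ (ZMod 3) (Finsupp.single y t) = counitRing ℤ t • y :=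
      freeLift_single _ _ _ _
    rw [h1, h2, smul_eq_mul, Int.cast_mul, Int.cast_natCast, ZMod.natCast_zmod_val,
      zsmul_eq_mul]

/-- The morphism `(ℤ; ℤ) → (ℤ[ℤ]; ℤ[ℤ](ℤ/3))` that sends `1` to the basis element of `1`. -/
def unitFree : ℤ →ₛₗ[Int.castRingHom (MvPolynomial ℤ ℤ)] (ZMod 3 →₀ MvPolynomial ℤ ℤ) where
  toFun k := k • Finsupp.single 1 1
  map_add' _ _ := add_smul _ _ _
  map_smul' r k := by
    rw [smul_eq_mul, mul_smul, eq_intCast, Int.cast_smul_eq_zsmul]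

theorem unitFree_apply (k : ℤ) : unitFree k = k • Finsupp.single 1 1 := rfl

theorem evalFree_unitFree (k : ℤ) : evalFree (unitFree k) = k := by
  have h : evalFree (Finsupp.single 1 1) = 1 :=
    (freeLift_single _ _ _ _).trans (by rw [map_one, one_smul]; rfl)
  rw [unitFree_apply, map_zsmul, h, smul_eq_mul, mul_one]

open MvPolynomial in
/-- The ring part of a morphism `FU(ℤ; ℤ/3) → FUFU(ℤ; ℤ/3)` which relates the identity to
`unitFree ∘ evalFree`. -/
def homotopyRing : MvPolynomial ℤ ℤ →+* MvPolynomial (MvPolynomial ℤ ℤ) ℤ :=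
  -- The counit of the free object sends the three terms to `X n`, `n`, `n`, with total `X n`.
  -- Applying the free functor to the counit sends them to `X n`, `X n`, `n`, with total `n`.
  eval₂Hom (Int.castRingHom _) fun n => X (X n) - X (C n) + C n

/-- The module part of a morphism `FU(ℤ; ℤ/3) → FUFU(ℤ; ℤ/3)` which relates the identity to
`unitFree ∘ evalFree`. -/
def homotopyModule : (ZMod 3 →₀ MvPolynomial ℤ ℤ) →ₛₗ[homotopyRing]
    ((ZMod 3 →₀ MvPolynomial ℤ ℤ) →₀ MvPolynomial (MvPolynomial ℤ ℤ) ℤ) :=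
  -- With e the basis vectors and k = `m.val`, the counit gives e_m - k e_1 + k e_1 = e_m, while the
  -- free functor applied to the counit gives e_m - e_m + k e_1.
  freeLift homotopyRing fun m => Finsupp.single (Finsupp.single m 1) 1 -
    Finsupp.single (unitFree m.val) 1 + (m.val : ℤ) • Finsupp.single (Finsupp.single 1 1) 1

theorem counitRing_homotopyRing (p : MvPolynomial ℤ ℤ) :
    counitRing (MvPolynomial ℤ ℤ) (homotopyRing p) = p := by
  refine RingHom.congr_fun (f := (counitRing (MvPolynomial ℤ ℤ)).comp homotopyRing)
    (g := RingHom.id _) ?_ p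
  refine MvPolynomial.ringHom_ext' (RingHom.ext_int _ _) fun n => ?_
  have h : MvPolynomial.eval₂ (Int.castRingHom (MvPolynomial ℤ ℤ)) id (n : MvPolynomial _ ℤ) =
      (n : MvPolynomial ℤ ℤ) := map_intCast (MvPolynomial.eval₂Hom _ _) n
  simp [counitRing, homotopyRing, h]

theorem freeMapRing_homotopyRing (p : MvPolynomial ℤ ℤ) :
    freeMapRing (counitRing ℤ) (homotopyRing p) = Int.castRingHom _ (counitRing ℤ p) := by
  refine RingHom.congr_fun (f := (freeMapRing (counitRing ℤ)).comp homotopyRing)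
    (g := (Int.castRingHom _).comp (counitRing ℤ)) ?_ p
  ext <;> simp [counitRing, homotopyRing, freeMapRing]

theorem counitModule_unitFree (k : ℤ) : counitModule ℤ (ZMod 3) (unitFree k) = k := by
  rw [← evalFree_cast, evalFree_unitFree]

theorem counitModule_homotopyModule (q : ZMod 3 →₀ MvPolynomial ℤ ℤ) :
    counitModule (MvPolynomial ℤ ℤ) (ZMod 3 →₀ MvPolynomial ℤ ℤ) (homotopyModule q) = q := by
  induction q using Finsupp.induction_linear with
  | zero => simp only [map_zero]
  | add p q hp hq => simp only [map_add, hp, hq]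
  | single m t =>
    unfold homotopyModule
    rw [freeLift_single, map_smulₛₗ, counitRing_homotopyRing, map_add, map_sub, map_zsmul,
      counitModule_single_one, counitModule_single_one, counitModule_single_one, unitFree_apply,
      sub_add_cancel, Finsupp.smul_single, smul_eq_mul, mul_one]

theorem freeMapModule_homotopyModule (q : ZMod 3 →₀ MvPolynomial ℤ ℤ) :
    freeMapModule (counitRing ℤ) (counitModule ℤ (ZMod 3)) (homotopyModule q) =
      unitFree (evalFree q) := by
  induction q using Finsupp.induction_linear with
  | zero => simp only [map_zero]
  | add p q hp hq => simp only [map_add, hp, hq]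
  | single m t =>
    have h1 : evalFree (Finsupp.single m t) = counitRing ℤ t • (m.val : ℤ) :=
      freeLift_single _ _ _ _
    unfold homotopyModule
    rw [freeLift_single, map_smulₛₗ, freeMapRing_homotopyRing, map_add, map_sub, map_zsmul,
      freeMapModule_single_one, freeMapModule_single_one, freeMapModule_single_one,
      counitModule_single_one, counitModule_single_one, counitModule_unitFree, Int.cast_natCast,
      ZMod.natCast_zmod_val, sub_self, zero_add, h1, map_smulₛₗ, unitFree_apply]

/-- An element of `FUFU(ℤ; ℤ/3)` with images `0` and `unitFree 3`. -/
def threeRelation : (ZMod 3 →₀ MvPolynomial ℤ ℤ) →₀ MvPolynomial (MvPolynomial ℤ ℤ) ℤ :=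
  -- The counit gives 3e_1 - 3e_1 + 0. The other map gives 3e_1 - e_0 + e_0, as 3 = 0 in `ℤ/3`; the
  -- last summand is there to cancel e_0, which is a nonzero basis vector.
  (3 : ℤ) • Finsupp.single (unitFree 1) 1 - Finsupp.single (unitFree 3) 1 + Finsupp.single 0 1

theorem counitModule_threeRelation :
    counitModule (MvPolynomial ℤ ℤ) (ZMod 3 →₀ MvPolynomial ℤ ℤ) threeRelation = 0 := by
  unfold threeRelation
  rw [map_add, map_sub, map_zsmul, counitModule_single_one, counitModule_single_one,
    counitModule_single_one, unitFree_apply, unitFree_apply, one_smul, sub_self, zero_add]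

theorem freeMapModule_threeRelation :
    freeMapModule (counitRing ℤ) (counitModule ℤ (ZMod 3)) threeRelation = unitFree 3 := by
  have h3 : ((3 : ℤ) : ZMod 3) = 0 := by decide
  unfold threeRelation
  rw [map_add, map_sub, map_zsmul, freeMapModule_single_one, freeMapModule_single_one,
    freeMapModule_single_one, map_zero, counitModule_unitFree, counitModule_unitFree, h3,
    sub_add_cancel, unitFree_apply, Int.cast_one]

end Presentation

/-! ### The Witt vectors of `(ℤ; ℤ/3)` -/

section WittZModThree

/-- Used for `evalFree` and `unitFree`, to which `wittFreeMap` does not apply because `(ℤ; ℤ)` is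
not given as a free object. -/
theorem ghostGroupMap_mem_closure {G : Type*} [Group G] [Finite G] (c : Choices G)
    {R R' M M' : Type*} [CommRing R] [CommRing R'] [AddCommGroup M] [Module R M]
    [AddCommGroup M'] [Module R' M'] (α : R →+* R') (f : M →ₛₗ[α] M') {a : ghostGroup G R M}
    (ha : a ∈ AddSubgroup.closure (Set.range (ghostMap R M c))) :
    ghostGroupMap G α f a ∈ AddSubgroup.closure (Set.range (ghostMap R' M' c)) := by
  induction ha using AddSubgroup.closure_induction with
  | mem _ h =>
    obtain ⟨n, rfl⟩ := h
    rw [ghostGroupMap_ghostMap]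
    exact AddSubgroup.subset_closure ⟨_, rfl⟩
  | zero => rw [map_zero]; exact zero_mem _
  | add a b _ _ ha hb => rw [map_add]; exact add_mem ha hb
  | neg a _ ha => rw [map_neg]; exact neg_mem ha

theorem evalFree_cast_eq (q : (ZMod 3 →₀ MvPolynomial ℤ ℤ) →₀ MvPolynomial (MvPolynomial ℤ ℤ) ℤ) :
    (evalFree (counitModule (MvPolynomial ℤ ℤ) (ZMod 3 →₀ MvPolynomial ℤ ℤ) q) : ZMod 3) =
      evalFree (freeMapModule (counitRing ℤ) (counitModule ℤ (ZMod 3)) q) := by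
  rw [evalFree_cast, evalFree_cast, counitModule_counitModule]

theorem intTensor_evalFree_cast_eq {I : Type*} [Finite I]
    (t : ⨂[MvPolynomial (MvPolynomial ℤ ℤ) ℤ] _ : I,
      ((ZMod 3 →₀ MvPolynomial ℤ ℤ) →₀ MvPolynomial (MvPolynomial ℤ ℤ) ℤ)) :
    (intTensor I (tensorMap _ evalFree I (tensorMap _
        (counitModule (MvPolynomial ℤ ℤ) (ZMod 3 →₀ MvPolynomial ℤ ℤ)) I t)) : ZMod 3) =
      intTensor I (tensorMap _ evalFree I (tensorMap _
        (freeMapModule (counitRing ℤ) (counitModule ℤ (ZMod 3))) I t)) := by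
  have := Fintype.ofFinite I
  induction t using PiTensorProduct.induction_on with
  | smul_tprod r m =>
    simp only [map_smulₛₗ, tensorMap_tprod, intTensor_tprod, counitRing_counitRing,
      smul_eq_mul, Int.cast_mul, Int.cast_prod, evalFree_cast_eq, RingHom.id_apply]
  | add x y hx hy => simp only [map_add, Int.cast_add, hx, hy]

variable {c : Choices (DihedralGroup 3)} (v : RepsByCard c)

/-- Both sides are additive in `z`, so ghost vectors suffice; for these the two families of
components agree mod 3, and the reduced marks see no more. -/
theorem reducedMarks_evalFree_eq
    {z : ghostGroup (DihedralGroup 3) (MvPolynomial (MvPolynomial ℤ ℤ) ℤ)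
      ((ZMod 3 →₀ MvPolynomial ℤ ℤ) →₀ MvPolynomial (MvPolynomial ℤ ℤ) ℤ)}
    (hz : z ∈ wittFree c (MvPolynomial ℤ ℤ) (ZMod 3 →₀ MvPolynomial ℤ ℤ)) :
    reducedMarks v (ghostGroupMap _ _ evalFree (ghostGroupMap _ _
        (counitModule (MvPolynomial ℤ ℤ) (ZMod 3 →₀ MvPolynomial ℤ ℤ)) z)) =
      reducedMarks v (ghostGroupMap _ _ evalFree (ghostGroupMap _ _
        (freeMapModule (counitRing ℤ) (counitModule ℤ (ZMod 3))) z)) := by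
  unfold wittFree at hz
  induction hz using AddSubgroup.closure_induction with
  | mem _ h =>
    obtain ⟨n, rfl⟩ := h
    simp only [ghostGroupMap_ghostMap]
    exact reducedMarks_ghostMap_congr v fun V => intTensor_evalFree_cast_eq _
  | zero => simp only [map_zero]
  | add a b _ _ ha hb => simp only [map_add, ha, hb]
  | neg a _ ha => simp only [map_neg, ha]

/-- Tensors over `ℤ` divisible by `3` become zero in the coequaliser. -/
theorem exists_tensorMap_eq {I : Type*} [Finite I] [Nonempty I] (n : ⨂[ℤ] _ : I, ℤ)
    (hn : (intTensor I n : ZMod 3) = 0) :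
    ∃ t : ⨂[MvPolynomial (MvPolynomial ℤ ℤ) ℤ] _ : I,
      ((ZMod 3 →₀ MvPolynomial ℤ ℤ) →₀ MvPolynomial (MvPolynomial ℤ ℤ) ℤ),
      tensorMap _ (counitModule (MvPolynomial ℤ ℤ) (ZMod 3 →₀ MvPolynomial ℤ ℤ)) I t = 0 ∧
      tensorMap _ (freeMapModule (counitRing ℤ) (counitModule ℤ (ZMod 3))) I t =
        tensorMap _ unitFree I n := by
  classical
  obtain ⟨k, hk⟩ := (ZMod.intCast_zmod_eq_zero_iff_dvd _ 3).1 hn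
  let i : I := Classical.arbitrary I
  let m : I → (ZMod 3 →₀ MvPolynomial ℤ ℤ) →₀ MvPolynomial (MvPolynomial ℤ ℤ) ℤ :=
    -- One factor is `threeRelation`, which makes the counit image vanish; the other factors go to
    -- `unitFree 1`, so the second image is that of 3, scaled by `k`. `Nonempty I` provides the
    -- slot.
    Function.update (fun _ => Finsupp.single (unitFree 1) 1) i threeRelation
  refine ⟨k • PiTensorProduct.tprod _ m, ?_, ?_⟩
  · rw [map_zsmul, tensorMap_tprod]
    have h : PiTensorProduct.tprod (MvPolynomial ℤ ℤ) (fun j =>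
        counitModule (MvPolynomial ℤ ℤ) (ZMod 3 →₀ MvPolynomial ℤ ℤ) (m j)) = 0 :=
      MultilinearMap.map_coord_zero _ i (by simp [m, counitModule_threeRelation])
    rw [h]
    exact zsmul_zero k
  · have h : (fun j => freeMapModule (counitRing ℤ) (counitModule ℤ (ZMod 3)) (m j)) =
        fun j => unitFree (Function.update (fun _ => (1 : ℤ)) i (3 : ℤ) j) := by
      ext1 j
      by_cases hj : j = i
      · subst hj
        simp [m, freeMapModule_threeRelation]
      · simp only [m, Function.update_of_ne hj, freeMapModule_single_one, counitModule_unitFree]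
        rw [unitFree_apply, one_smul, Int.cast_one]
    rw [map_zsmul, tensorMap_tprod, h, ← tensorMap_tprod, ← map_zsmul]
    congr 1
    have := Fintype.ofFinite I
    apply (intTensor I).injective
    rw [map_zsmul, intTensor_tprod, Finset.prod_update_of_mem (Finset.mem_univ i), hk]
    simp [mul_comm]

/-- The homomorphism on `W(ℤ[ℤ]; ℤ[ℤ](ℤ/3))` whose kernel is the image of the relations. -/
def wittReducedMarks : wittFree c ℤ (ZMod 3) →+ (ZMod 3 × ZMod 3) × ZMod 9 :=
  (reducedMarks v).comp ((ghostGroupMap _ (counitRing ℤ) evalFree).comp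
    (wittFree c ℤ (ZMod 3)).subtype)

theorem wittReducedMarks_apply (x : wittFree c ℤ (ZMod 3)) :
    wittReducedMarks v x = reducedMarks v (ghostGroupMap _ (counitRing ℤ) evalFree x.1) := rfl

theorem wittReducedMarks_surjective : Function.Surjective (wittReducedMarks v) := by
  intro y
  obtain ⟨n, rfl⟩ := exists_reducedMarks_ghostMap_eq v y
  refine ⟨⟨ghostGroupMap _ _ unitFree (ghostMap ℤ ℤ c n),
    ghostGroupMap_mem_closure c _ _ (AddSubgroup.subset_closure ⟨n, rfl⟩)⟩, ?_⟩
  rw [wittReducedMarks_apply,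
    ghostGroupMap_ghostGroupMap (γ := RingHom.id ℤ) unitFree evalFree LinearMap.id
      (fun r => by simp) evalFree_unitFree,
    ghostGroupMap_eq_self _ (fun _ => rfl) fun _ => rfl]

theorem ker_wittReducedMarks : (wittReducedMarks v).ker =
    (wittFreeMap c (counitRing (MvPolynomial ℤ ℤ))
        (counitModule (MvPolynomial ℤ ℤ) (ZMod 3 →₀ MvPolynomial ℤ ℤ)) -
      wittFreeMap c (freeMapRing (counitRing ℤ))
        (freeMapModule (counitRing ℤ) (counitModule ℤ (ZMod 3)))).range := by
  ext x
  rw [AddMonoidHom.mem_ker]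
  constructor
  · intro hx
    obtain ⟨n, hn⟩ := exists_ghostMap_eq (ghostGroupMap_mem_closure c _ evalFree x.2)
    rw [wittReducedMarks_apply, ← hn] at hx
    choose t ht₁ ht₂ using fun V : c.reps =>
      exists_tensorMap_eq (n V) (intTensor_eq_zero_of_reducedMarks_eq_zero v hx V)
    -- With u the image of `x` under `unitFree ∘ evalFree`, the two maps send `z₁` to x and u, and
    -- `z₂` to 0 and u. The difference of the maps therefore sends `z₁ - z₂` to x.
    let z₁ := wittFreeMap c homotopyRing homotopyModule x
    let z₂ : wittFree c (MvPolynomial ℤ ℤ) (ZMod 3 →₀ MvPolynomial ℤ ℤ) :=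
      ⟨ghostMap _ _ c t, AddSubgroup.subset_closure ⟨t, rfl⟩⟩
    have h₁ : wittFreeMap c (counitRing (MvPolynomial ℤ ℤ))
        (counitModule (MvPolynomial ℤ ℤ) (ZMod 3 →₀ MvPolynomial ℤ ℤ)) z₁ = x := by
      refine Subtype.ext ?_
      change ghostGroupMap _ _ _ (ghostGroupMap _ _ _ x.1) = x.1
      rw [ghostGroupMap_ghostGroupMap (γ := RingHom.id _) _ _ LinearMap.id
        counitRing_homotopyRing counitModule_homotopyModule,
        ghostGroupMap_eq_self _ (fun _ => rfl) fun _ => rfl]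
    have h₂ : wittFreeMap c (counitRing (MvPolynomial ℤ ℤ))
        (counitModule (MvPolynomial ℤ ℤ) (ZMod 3 →₀ MvPolynomial ℤ ℤ)) z₂ = 0 := by
      refine Subtype.ext ?_
      change ghostGroupMap _ _ _ (ghostMap _ _ c t) = 0
      rw [ghostGroupMap_ghostMap]
      -- The ghost map is not additive, so its value 0 at the zero vector is imported from `(ℤ; ℤ)`
      -- by naturality.
      have h := ghostGroupMap_ghostMap c _ unitFree 0
      rw [ghostMap_int_zero, map_zero] at h
      rw [h]
      refine congrArg _ (funext fun V => (ht₁ V).trans ?_)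
      exact (map_zero _).symm
    have h₃ : wittFreeMap c (freeMapRing (counitRing ℤ))
        (freeMapModule (counitRing ℤ) (counitModule ℤ (ZMod 3))) z₁ =
      wittFreeMap c (freeMapRing (counitRing ℤ))
        (freeMapModule (counitRing ℤ) (counitModule ℤ (ZMod 3))) z₂ := by
      refine Subtype.ext ?_
      change ghostGroupMap _ _ _ (ghostGroupMap _ _ _ x.1) =
        ghostGroupMap _ _ _ (ghostMap _ _ c t)
      let γ : MvPolynomial ℤ ℤ →+* MvPolynomial ℤ ℤ :=
        (Int.castRingHom (MvPolynomial ℤ ℤ)).comp (counitRing ℤ)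
      have : RingHomCompTriple (counitRing ℤ) (Int.castRingHom (MvPolynomial ℤ ℤ)) γ := ⟨rfl⟩
      rw [ghostGroupMap_ghostGroupMap (γ := γ) _ _
          (unitFree.comp evalFree) freeMapRing_homotopyRing freeMapModule_homotopyModule,
        ← ghostGroupMap_ghostGroupMap (γ := γ) evalFree unitFree
          (unitFree.comp evalFree) (fun _ => rfl) fun _ => rfl, ← hn, ghostGroupMap_ghostMap,
        ghostGroupMap_ghostMap]
      exact congrArg _ (funext fun V => (ht₂ V).symm)
    refine ⟨z₁ - z₂, ?_⟩
    rw [AddMonoidHom.sub_apply, map_sub, map_sub, h₁, h₂, h₃, sub_self, sub_zero, sub_zero]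
  · rintro ⟨z, rfl⟩
    rw [AddMonoidHom.sub_apply, map_sub, sub_eq_zero]
    exact reducedMarks_evalFree_eq v z.2

/-- `W(ℤ; ℤ/3) ≅ (ℤ/3)² ⊕ ℤ/9` for the dihedral group of order `6`. -/
def wittVectorsEquiv : WittVectors c ℤ (ZMod 3) ≃+ (ZMod 3 × ZMod 3) × ZMod 9 :=
  (QuotientAddGroup.quotientAddEquivOfEq (ker_wittReducedMarks v).symm).trans
    (QuotientAddGroup.quotientKerEquivOfSurjective _ (wittReducedMarks_surjective v))

end WittZModThree

end GWitt

end

theorem mainTheorem10 (c : GWitt.Choices (DihedralGroup 3)) :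
    Nat.card (GWitt.WittVectors c ℤ (ZMod 3)) = 81 ∧
      Nonempty (GWitt.WittVectors c ℤ (ZMod 3) ≃+ (ZMod 3 × ZMod 3) × ZMod 9) := by
  obtain ⟨v⟩ := GWitt.nonempty_repsByCard c
  refine ⟨?_, ⟨GWitt.wittVectorsEquiv v⟩⟩
  rw [Nat.card_congr (GWitt.wittVectorsEquiv v).toEquiv]
  simp
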